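/- Let $(\mathcal X,\mathfrak S,\mu)$ be a $\sigma$-finite measure space with an increasing sequence of $\sigma$-algebras $\mathfrak S_n\subset\mathfrak S_{n+1}\subset\mathfrak S$, $n\in\mathbb Z$. Assume that each $\mathfrak S_n$ is atomic: there is a countable disjoint collection $\mathscr D_n\subset\mathfrak S_n$ of sets of positive finite measure (atoms) such that every $A\in\mathfrak S_n$ is a union of sets from $\mathscr D_n$. Put $\mathscr D=\bigcup_{n}\mathscr D_n$, $|A|=\mu(A)$ and $\langle g\rangle_I=|I|^{-1}\int_I g\,d\mu$. For $I\in\mathscr D$ the collection $\operatorname{ch}(I)$ of its children consists of the $J\in\mathscr D_{n+1}$ with $J\subset I$, where $n$ is the largest integer with $I\in\mathscr D_n$; if $I\in\mathscr D_n$ for all sufficiently large $n$, then $\operatorname{ch}(I)=\{I\}$. Let $$\Delta_I g=\sum_{J\in\operatorname{ch}(I)}\langle g\rangle_J\mathbf 1_J-\langle g\rangle_I\mathbf 1_I ,\qquad \|g\|_{L^1(I)}=|I|^{-1}\int_I|g|\,d\mu .$$ Let $u\ge 0$ be a weight, i.e. a measurable function with $\int_I u\,d\mu<\infty$ for all $I\in\mathscr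 D$. For $I\in\mathscr D$ put $$\mathbf u_I=\langle u\rangle_I,\qquad \mathbf u_I^*=\|u\|_{\Lambda_{\psi_0}(I)}=\int_0^1 u_I^{*}(s)\,d\psi_0(s)\in[0,\infty],\qquad \psi_0(s)=s\ln(e/s),$$ where $u_I^{*}(s)=\inf\{t\ge0:\ |I|^{-1}|\{x\in I:u(x)>t\}|\le s\}$ is the decreasing rearrangement of $u$ on the probability space $(I,|I|^{-1}\mu)$. Let $\alpha:[1,\infty)\to[0,\infty)$ be an increasing function such that $$C_\alpha:=\frac1{\alpha(1)}+\int_1^\infty\frac{dt}{t\,\alpha(t)}<\infty .$$ Then for every real- or complex-valued $f\in L^2(u)=L^2(\mathcal X,u\,d\mu)$ $$\sum_{I\in\mathscr D}\frac{\|\Delta_I(fu)\|_{L^1(I)}^2}{\alpha(\mathbf u_I^*/\mathbf u_I)\,\mathbf u_I^*}\,|I|\ \le\ 36\,C_\alpha\,\|f\|_{L^2(u)}^2 ,$$ where the term of an atom $I$ is understood as $0$ if $\mathbf u_I=0$ or $\mathbf u_I^*=\infty$. -/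

import Mathlib

open MeasureTheory Set
open scoped ENNReal NNReal

/-- A `ℤ`-indexed filtration of sub-σ-algebras on the measure space `(X, μ)` all of whose members
are atomic: the `n`-th σ-algebra comes with a countable disjoint collection `atoms n` of sets of
positive (and finite) measure such that each set of that σ-algebra is a union of such atoms. -/
structure AtomicFiltration {X : Type*} [mX : MeasurableSpace X] (μ : Measure X) where
  filtration : Filtration ℤ mX
  atoms : ℤ → Set (Set X)
  countable_atoms : ∀ n, (atoms n).Countable
  disjoint_atoms : ∀ n, (atoms n).PairwiseDisjoint id
  measurableSet_atoms : ∀ n, ∀ I ∈ atoms n, MeasurableSet[filtration n] I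
  measure_atoms_pos : ∀ n, ∀ I ∈ atoms n, 0 < μ I
  measure_atoms_lt_top : ∀ n, ∀ I ∈ atoms n, μ I < ∞
  exists_eq_sUnion : ∀ n, ∀ A : Set X, MeasurableSet[filtration n] A →
    ∃ T : Set (Set X), T ⊆ atoms n ∧ A = ⋃₀ T

namespace AtomicFiltration

variable {X : Type*} [MeasurableSpace X] {μ : Measure X}

/-- The collection of the atoms of all generations (an atom that belongs to several generations
is one element of it). -/
def allAtoms (D : AtomicFiltration μ) : Set (Set X) :=
  ⋃ n, D.atoms n

/-- The children of an atom `I`: if `n` is the last generation that contains `I`, they are the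
atoms of generation `n + 1` inside `I`; if `I` belongs to all sufficiently late generations, then
`I` is its own only child. -/
def children (D : AtomicFiltration μ) (I : Set X) : Set (Set X) :=
  {J | (∃ n, IsGreatest {k | I ∈ D.atoms k} n ∧ J ∈ D.atoms (n + 1) ∧ J ⊆ I) ∨
    ((∃ n, ∀ k, n ≤ k → I ∈ D.atoms k) ∧ J = I)}

/-- The martingale difference
`Δ_I g = ∑_{J a child of I} ⟨g⟩_J 1_J - ⟨g⟩_I 1_I`. -/
noncomputable def martingaleDiff {𝕜 : Type*} [RCLike 𝕜] (D : AtomicFiltration μ) (I : Set X)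
    (g : X → 𝕜) (x : X) : 𝕜 :=
  (∑' J : D.children I, (J : Set X).indicator (fun _ => ⨍ y in (J : Set X), g y ∂μ) x) -
    I.indicator (fun _ => ⨍ y in I, g y ∂μ) x

end AtomicFiltration

/-- The decreasing rearrangement `s ↦ inf {t ≥ 0 | N(t) ≤ s}` of a nonnegative function `u`,
where `N(t) = ν {u > t}` is its distribution function. -/
noncomputable def decreasingRearrangement {X : Type*} [MeasurableSpace X] (ν : Measure X)
    (u : X → ℝ≥0) (s : ℝ) : ℝ≥0∞ :=
  sInf {t : ℝ≥0∞ | ν {x | t < (u x : ℝ≥0∞)} ≤ ENNReal.ofReal s}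

/-- `ψ₀(s) = s ln (e / s)`, with `ψ₀(0) = 0`; it is used for `s ∈ [0, 1]`. -/
noncomputable def psiZero (s : ℝ) : ℝ :=
  s * Real.log (Real.exp 1 / s)

theorem psiZero_eq (s : ℝ) : psiZero s = s + Real.negMulLog s := by
  rcases eq_or_ne s 0 with rfl | hs
  · simp [psiZero]
  · rw [psiZero, Real.log_div (Real.exp_ne_zero 1) hs, Real.log_exp, Real.negMulLog]
    ring

theorem continuous_psiZero : Continuous psiZero := by
  have h : psiZero = fun s => s + Real.negMulLog s := funext psiZero_eq
  rw [h]
  exact continuous_id.add Real.continuous_negMulLog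

theorem monotoneOn_psiZero : MonotoneOn psiZero (Icc 0 1) := by
  apply monotoneOn_of_deriv_nonneg (convex_Icc 0 1) continuous_psiZero.continuousOn
  · intro x hx
    rw [interior_Icc] at hx
    have h : psiZero = fun s => s + Real.negMulLog s := funext psiZero_eq
    rw [h]
    exact (differentiableAt_id.add
      (Real.hasDerivAt_negMulLog hx.1.ne').differentiableAt).differentiableWithinAt
  · intro x hx
    rw [interior_Icc] at hx
    have h : psiZero = fun s => s + Real.negMulLog s := funext psiZero_eq
    have h2 : HasDerivAt psiZero (1 + (-Real.log x - 1)) x := by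
      rw [h]
      exact (hasDerivAt_id x).add (Real.hasDerivAt_negMulLog hx.1.ne')
    rw [h2.deriv]
    have := Real.log_nonpos hx.1.le hx.2.le
    linarith

/-- The function `ψ₀` on `[0, 1]`, extended to be constant outside, as a Stieltjes function; its
measure is `dψ₀`. -/
noncomputable def psiZeroStieltjes : StieltjesFunction ℝ where
  toFun s := psiZero (max 0 (min s 1))
  mono' := by
    intro a b hab
    exact monotoneOn_psiZero ⟨le_max_left _ _, max_le zero_le_one (min_le_right _ _)⟩
      ⟨le_max_left _ _, max_le zero_le_one (min_le_right _ _)⟩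
      (max_le_max le_rfl (min_le_min hab le_rfl))
  right_continuous' := by
    intro x
    have h : Continuous fun s : ℝ => psiZero (max 0 (min s 1)) :=
      continuous_psiZero.comp (continuous_const.max (continuous_id.min continuous_const))
    exact h.continuousWithinAt

/-- The Lorentz norm `‖u‖_{Λ_{ψ₀}} = ∫₀¹ u^*(s) dψ₀(s)` of a nonnegative function `u` on a
probability space; it may be infinite. -/
noncomputable def lorentzNorm {X : Type*} [MeasurableSpace X] (ν : Measure X)
    (u : X → ℝ≥0) : ℝ≥0∞ :=
  ∫⁻ s in Ioc 0 1, decreasingRearrangement ν u s ∂psiZeroStieltjes.measure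

/-- The entropy bump `α(‖u‖_{Λ_{ψ₀}} / ‖u‖_{L¹}) ‖u‖_{Λ_{ψ₀}}` of `u` on a probability space,
understood as `∞` when `‖u‖_{Λ_{ψ₀}} = ∞`. -/
noncomputable def entropyBump {X : Type*} [MeasurableSpace X] (α : ℝ → ℝ≥0) (ν : Measure X)
    (u : X → ℝ≥0) : ℝ≥0∞ :=
  open Classical in
  if lorentzNorm ν u = ∞ then ∞
  else (α (lorentzNorm ν u / ∫⁻ x, (u x : ℝ≥0∞) ∂ν).toReal : ℝ≥0∞) * lorentzNorm ν u

/-- `C_α = 1 / α(1) + ∫₁^∞ dt / (t α(t))`, with values in `[0, ∞]`. -/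
noncomputable def bumpConst (α : ℝ → ℝ≥0) : ℝ≥0∞ :=
  (α 1 : ℝ≥0∞)⁻¹ + ∫⁻ t in Ioi (1 : ℝ), (ENNReal.ofReal t * (α t : ℝ≥0∞))⁻¹

/-!
The proof is a Bellman function argument. Write `x`, `v`, `w` for the average of `g = f u`, the
average of `u` and the Lorentz norm of `u` on an atom, and let `C = C_α`. The Bellman function is
`2 C |x|² / v + 32 C² |x|² / (v φ(w / v))`, where the concave profile `φ` has slope `1 / (t α(t))`
and satisfies `C ≤ φ ≤ 2 C`.

When an atom is split into its children, `Δ g = (x_J - x_I)_J` is the sum of the part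
`x_J - v_J x_I / v_I`, whose square is the convexity defect of `|x|² / v`, and of
`(v_J - v_I) x_I / v_I`. For the latter part, let `d` be the mean of `|v_J - v_I|`. The entropy
`ψ₀(s) = s - s ln s` is concave enough to make the mean of the `w_J` smaller than `w_I` by at least
`d² / (4 v_I)`. By concavity of `v φ(w / v)`, whose derivative in `w` is the slope of `φ` at
`w / v`, this becomes a gain of `d² / (4 α(w / v) w)` in the denominator of the second summand.

Since the Bellman function is at most `34 C |x|² / v`, and `|x|² / v` is at most the average of
`|g|² / u = |f|² u` by the Cauchy-Schwarz inequality, the gains sum telescopically over all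
generations.
-/

section Rearrangement

open Filter

variable {X : Type*} [MeasurableSpace X] {ν : Measure X} {u : X → ℝ≥0}

theorem measure_decreasingRearrangement_lt_le (s : ℝ) :
    ν {x | decreasingRearrangement ν u s < (u x : ℝ≥0∞)} ≤ ENNReal.ofReal s := by
  set levels : Set ℝ≥0∞ := {t | ν {x | t < (u x : ℝ≥0∞)} ≤ ENNReal.ofReal s} with h_levels
  have hne : levels.Nonempty := ⟨∞, by simp [h_levels]⟩
  obtain ⟨t, ht_anti, ht_lim, ht_mem⟩ := exists_seq_tendsto_sInf hne (OrderBot.bddBelow levels)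
  have h_iUnion : {x | decreasingRearrangement ν u s < (u x : ℝ≥0∞)} =
      ⋃ k, {x | t k < (u x : ℝ≥0∞)} := by
    ext x
    simp only [mem_ofPred_eq, mem_iUnion]
    exact ⟨fun h => (ht_lim.eventually_lt_const h).exists,
      fun ⟨k, hk⟩ => (sInf_le (ht_mem k)).trans_lt hk⟩
  rw [h_iUnion, Monotone.measure_iUnion]
  · exact iSup_le ht_mem
  · exact fun k l hkl x hx => (ht_anti hkl).trans_lt hx

theorem lt_decreasingRearrangement_iff {s : ℝ} {t : ℝ≥0∞} :
    t < decreasingRearrangement ν u s ↔ ENNReal.ofReal s < ν {x | t < (u x : ℝ≥0∞)} := by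
  constructor
  · contrapose!
    exact fun h => sInf_le h
  · contrapose!
    exact fun h => (measure_mono fun x hx => h.trans_lt hx).trans
      (measure_decreasingRearrangement_lt_le s)

theorem volume_restrict_Ioi_setOf_ofReal_lt (c : ℝ≥0∞) :
    volume.restrict (Ioi (0 : ℝ)) {t | ENNReal.ofReal t < c} = c := by
  rw [Measure.restrict_apply (measurableSet_lt ENNReal.measurable_ofReal measurable_const)]
  induction c with
  | top => simp
  | coe c =>
    have h_Ioo : {t : ℝ | ENNReal.ofReal t < c} ∩ Ioi 0 = Ioo 0 (c : ℝ) := by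
      ext t
      simp only [mem_inter_iff, mem_ofPred_eq, mem_Ioi, mem_Ioo, and_comm (b := 0 < t)]
      exact and_congr_right fun ht => ENNReal.ofReal_lt_coe_iff ht.le
    rw [h_Ioo, Real.volume_Ioo, sub_zero, ENNReal.ofReal_coe_nnreal]

theorem le_psiZero {s : ℝ} (hs : s ∈ Icc 0 1) : s ≤ psiZero s := by
  rw [psiZero_eq]
  exact le_add_of_nonneg_right (Real.negMulLog_nonneg hs.1 hs.2)

theorem psiZero_nonneg {s : ℝ} (hs : s ∈ Icc 0 1) : 0 ≤ psiZero s :=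
  hs.1.trans (le_psiZero hs)

theorem psiZeroStieltjes_measure_Ioo {n : ℝ} (hn : n ∈ Icc 0 1) :
    psiZeroStieltjes.measure (Ioo 0 n) = ENNReal.ofReal (psiZero n) := by
  have hc : Continuous psiZeroStieltjes :=
    continuous_psiZero.comp (continuous_const.max (continuous_id.min continuous_const))
  rw [StieltjesFunction.measure_Ioo, (hc.continuousAt (x := n)).continuousWithinAt.leftLim_eq]
  congr 1
  change psiZero (max 0 (min n 1)) - psiZero (max 0 (min 0 1)) = psiZero n
  simp [min_eq_left hn.2, max_eq_right hn.1, psiZero_eq 0]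

theorem psiZeroStieltjes_measure_restrict_setOf_ofReal_lt {c : ℝ≥0∞} (hc : c ≤ 1) :
    psiZeroStieltjes.measure.restrict (Ioc 0 1) {s | ENNReal.ofReal s < c} =
      ENNReal.ofReal (psiZero c.toReal) := by
  have hc_top : c ≠ ∞ := (hc.trans_lt ENNReal.one_lt_top).ne
  have hc_one : c.toReal ≤ 1 := ENNReal.toReal_mono ENNReal.one_ne_top hc
  rw [Measure.restrict_apply (measurableSet_lt ENNReal.measurable_ofReal measurable_const),
    ← psiZeroStieltjes_measure_Ioo ⟨ENNReal.toReal_nonneg, hc_one⟩]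
  congr 1
  ext s
  simp only [mem_inter_iff, mem_ofPred_eq, mem_Ioc, mem_Ioo]
  constructor
  · rintro ⟨h, hs, -⟩
    exact ⟨hs, (ENNReal.ofReal_lt_iff_lt_toReal hs.le hc_top).1 h⟩
  · rintro ⟨hs, h⟩
    exact ⟨(ENNReal.ofReal_lt_iff_lt_toReal hs.le hc_top).2 h, hs, h.le.trans hc_one⟩

theorem antitone_measure_setOf_lt {β : Type*} [Preorder β] (g : X → β) :
    Antitone fun t => ν {x | t < g x} :=
  fun _ _ h => measure_mono fun _ hx => lt_of_le_of_lt h hx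

/-- `s < N(t) ↔ t < u^*(s)`, so that both iterated integrals measure the same subgraph. -/
theorem lorentzNorm_eq_lintegral_psiZero [IsProbabilityMeasure ν] :
    lorentzNorm ν u =
      ∫⁻ t in Ioi (0 : ℝ), ENNReal.ofReal (psiZero (ν.real {x | t < (u x : ℝ)})) := by
  have h_anti : Antitone fun t : ℝ => ν {x | ENNReal.ofReal t < (u x : ℝ≥0∞)} :=
    (antitone_measure_setOf_lt _).comp_monotone ENNReal.ofReal_mono
  set A : Set (ℝ × ℝ) :=
    {p | ENNReal.ofReal p.1 < ν {x | ENNReal.ofReal p.2 < (u x : ℝ≥0∞)}}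
  have hA : MeasurableSet A := measurableSet_lt (ENNReal.measurable_ofReal.comp measurable_fst)
    (h_anti.measurable.comp measurable_snd)
  have h_left (s : ℝ) : decreasingRearrangement ν u s =
      ∫⁻ t in Ioi (0 : ℝ), A.indicator 1 (s, t) := by
    rw [← volume_restrict_Ioi_setOf_ofReal_lt (decreasingRearrangement ν u s)]
    simp_rw [lt_decreasingRearrangement_iff]
    exact (lintegral_indicator_one (measurableSet_lt measurable_const h_anti.measurable)).symm
  have h_right {t : ℝ} (ht : 0 ≤ t) :
      ∫⁻ s in Ioc 0 1, A.indicator 1 (s, t) ∂psiZeroStieltjes.measure =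
        ENNReal.ofReal (psiZero (ν.real {x | t < (u x : ℝ)})) := by
    simp_rw [measureReal_def, ← ENNReal.ofReal_lt_coe_iff ht]
    rw [← psiZeroStieltjes_measure_restrict_setOf_ofReal_lt prob_le_one]
    have h_meas : MeasurableSet {s | ENNReal.ofReal s < ν {x | ENNReal.ofReal t < (u x : ℝ≥0∞)}} :=
      measurableSet_lt ENNReal.measurable_ofReal measurable_const
    exact lintegral_indicator_one h_meas
  simp_rw [lorentzNorm, h_left]
  rw [lintegral_lintegral_swap (f := fun s t => A.indicator (1 : ℝ × ℝ → ℝ≥0∞) (s, t))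
    (measurable_one.indicator hA).aemeasurable]
  exact setLIntegral_congr_fun measurableSet_Ioi fun t ht => h_right (le_of_lt ht)

theorem lintegral_coe_eq_lintegral_measure_lt (hu : Measurable u) :
    ∫⁻ x, (u x : ℝ≥0∞) ∂ν = ∫⁻ t in Ioi (0 : ℝ), ν {x | t < (u x : ℝ)} := by
  simpa only [ENNReal.ofReal_coe_nnreal] using lintegral_eq_lintegral_meas_lt ν
    (Eventually.of_forall fun x => (u x).coe_nonneg) hu.coe_nnreal_real.aemeasurable

theorem measureReal_mem_Icc [IsProbabilityMeasure ν] (s : Set X) : ν.real s ∈ Icc (0 : ℝ) 1 :=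
  ⟨measureReal_nonneg, measureReal_le_one⟩

theorem lintegral_le_lorentzNorm [IsProbabilityMeasure ν] (hu : Measurable u) :
    ∫⁻ x, (u x : ℝ≥0∞) ∂ν ≤ lorentzNorm ν u := by
  rw [lorentzNorm_eq_lintegral_psiZero, lintegral_coe_eq_lintegral_measure_lt hu]
  refine lintegral_mono fun t => ?_
  rw [← ofReal_measureReal (μ := ν)]
  exact ENNReal.ofReal_le_ofReal (le_psiZero (measureReal_mem_Icc _))

end Rearrangement

section Entropy

/-- With `m = a²` and `n = b²` this is `log (b / a) ≤ b / a - 1`, which makes the gap between the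
concave `ψ₀` and its tangent at `n` at least `(a - b)²`, followed by Young's inequality. -/
theorem psiZero_add_mul_abs_sub_le {m n c : ℝ} (hm : 0 ≤ m) (hn : 0 < n) :
    psiZero m + c * |m - n| ≤ n - m * Real.log n + c ^ 2 * (m + n) / 2 := by
  rcases hm.eq_or_lt with rfl | hm
  · rw [psiZero_eq, zero_sub, abs_neg, abs_of_pos hn]
    simp only [Real.negMulLog_zero, zero_add, zero_mul, sub_zero]
    nlinarith [mul_nonneg hn.le (sq_nonneg (c - 1))]
  · obtain ⟨a, ha, rfl⟩ : ∃ a, 0 < a ∧ m = a ^ 2 :=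
      ⟨√m, Real.sqrt_pos.2 hm, (Real.sq_sqrt hm.le).symm⟩
    obtain ⟨b, hb, rfl⟩ : ∃ b, 0 < b ∧ n = b ^ 2 :=
      ⟨√n, Real.sqrt_pos.2 hn, (Real.sq_sqrt hn.le).symm⟩
    have h_log : Real.log b - Real.log a ≤ b / a - 1 := by
      rw [← Real.log_div hb.ne' ha.ne']
      exact Real.log_le_sub_one_of_pos (div_pos hb ha)
    have h_tangent : a ^ 2 * (Real.log b - Real.log a) ≤ a * b - a ^ 2 :=
      calc a ^ 2 * (Real.log b - Real.log a) ≤ a ^ 2 * (b / a - 1) := by gcongr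
        _ = a * b - a ^ 2 := by field_simp
    have h_abs : |a ^ 2 - b ^ 2| = |a - b| * (a + b) := by
      rw [sq_sub_sq, abs_mul, abs_of_pos (add_pos ha hb), mul_comm]
    rw [psiZero_eq, Real.negMulLog, Real.log_pow, Real.log_pow, h_abs]
    push_cast
    nlinarith [sq_nonneg (|a - b| - c * (a + b) / 2), sq_abs (a - b),
      mul_nonneg (sq_nonneg c) (sq_nonneg (a - b))]

variable {Ω : Type*} [MeasurableSpace Ω] {P : Measure Ω} [IsProbabilityMeasure P] {M : Ω → ℝ}

theorem integrable_psiZero (hM : Measurable M) (hM_mem : ∀ y, M y ∈ Icc 0 1) :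
    Integrable (fun y => psiZero (M y)) P :=
  .of_mem_Icc (psiZero 0) (psiZero 1) (continuous_psiZero.measurable.comp hM).aemeasurable
    (.of_forall fun y => ⟨monotoneOn_psiZero (by simp) (hM_mem y) (hM_mem y).1,
      monotoneOn_psiZero (hM_mem y) (by simp) (hM_mem y).2⟩)

theorem integral_psiZero_add_le (hM : Measurable M) (hM_mem : ∀ y, M y ∈ Icc 0 1) (c : ℝ) :
    ∫ y, psiZero (M y) ∂P + c * ∫ y, |M y - ∫ z, M z ∂P| ∂P ≤
      psiZero (∫ y, M y ∂P) + c ^ 2 * ∫ y, M y ∂P := by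
  have h_int : Integrable M P := .of_mem_Icc 0 1 hM.aemeasurable (.of_forall hM_mem)
  have h_int_psi : Integrable (fun y => psiZero (M y)) P := integrable_psiZero hM hM_mem
  set n := ∫ y, M y ∂P with hn
  have h_int_abs : Integrable (fun y => c * |M y - n|) P :=
    ((h_int.sub (integrable_const n)).abs).const_mul c
  have hn_nonneg : 0 ≤ n := integral_nonneg fun y => (hM_mem y).1
  rcases hn_nonneg.eq_or_lt with hn_zero | hn_pos
  · have h_zero : M =ᵐ[P] 0 :=
      (integral_eq_zero_iff_of_nonneg (fun y => (hM_mem y).1) h_int).1 hn_zero.symm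
    have h_psi : ∫ y, psiZero (M y) ∂P = ∫ _, psiZero 0 ∂P :=
      integral_congr_ae (h_zero.fun_comp psiZero)
    have h_abs : ∫ y, |M y - n| ∂P = ∫ _, |0 - n| ∂P :=
      integral_congr_ae (h_zero.fun_comp fun m => |m - n|)
    rw [h_psi, h_abs, ← hn_zero]
    simp
  · calc ∫ y, psiZero (M y) ∂P + c * ∫ y, |M y - n| ∂P
      _ = ∫ y, (psiZero (M y) + c * |M y - n|) ∂P := by
        rw [integral_add h_int_psi h_int_abs, integral_const_mul]
      _ ≤ ∫ y, (n + c ^ 2 / 2 * n + (c ^ 2 / 2 - Real.log n) * M y) ∂P := by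
        refine integral_mono (h_int_psi.add h_int_abs)
          ((integrable_const _).add (h_int.const_mul _)) fun y => ?_
        exact (psiZero_add_mul_abs_sub_le (hM_mem y).1 hn_pos).trans_eq (by ring)
      _ = psiZero n + c ^ 2 * n := by
        rw [integral_add (integrable_const _) (h_int.const_mul _), integral_const_mul, ← hn,
          integral_const, psiZero_eq, Real.negMulLog]
        simp only [probReal_univ, one_smul]
        ring

theorem lintegral_psiZero_add_le (hM : Measurable M) (hM_mem : ∀ y, M y ∈ Icc 0 1) (c : ℝ≥0) :
    ∫⁻ y, ENNReal.ofReal (psiZero (M y)) ∂P + c * ∫⁻ y, ‖M y - ∫ z, M z ∂P‖ₑ ∂P ≤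
      ENNReal.ofReal (psiZero (∫ y, M y ∂P)) + c ^ 2 * ENNReal.ofReal (∫ y, M y ∂P) := by
  have h_mean : 0 ≤ ∫ y, M y ∂P := integral_nonneg fun y => (hM_mem y).1
  have h_mean_mem : ∫ y, M y ∂P ∈ Icc (0 : ℝ) 1 :=
    ⟨h_mean, (integral_mono_of_nonneg (.of_forall fun y => (hM_mem y).1) (integrable_const 1)
      (.of_forall fun y => (hM_mem y).2)).trans_eq (by simp)⟩
  have h_int_sub : Integrable (fun y => M y - ∫ z, M z ∂P) P :=
    (Integrable.of_mem_Icc 0 1 hM.aemeasurable (.of_forall hM_mem)).sub (integrable_const _)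
  rw [← ofReal_integral_eq_lintegral_ofReal (integrable_psiZero hM hM_mem)
      (.of_forall fun y => psiZero_nonneg (hM_mem y)),
    ← ofReal_integral_norm_eq_lintegral_enorm h_int_sub, ← ENNReal.ofReal_coe_nnreal,
    ← ENNReal.ofReal_mul c.coe_nonneg, ← ENNReal.ofReal_pow c.coe_nonneg,
    ← ENNReal.ofReal_mul (by positivity),
    ← ENNReal.ofReal_add (integral_nonneg fun y => psiZero_nonneg (hM_mem y)) (by positivity),
    ← ENNReal.ofReal_add (psiZero_nonneg h_mean_mem) (by positivity)]
  exact ENNReal.ofReal_le_ofReal (integral_psiZero_add_le hM hM_mem c)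

end Entropy

section LorentzConcavity

open ProbabilityTheory

variable {X Y : Type*} [MeasurableSpace X] [MeasurableSpace Y] {κ : Kernel Y X} {P : Measure Y}
  {ν : Measure X} {u : X → ℝ≥0}

theorem measureReal_comp [IsMarkovKernel κ] {s : Set X} (hs : MeasurableSet s) :
    (κ ∘ₘ P).real s = ∫ y, (κ y).real s ∂P := by
  simp_rw [measureReal_def, Measure.bind_apply hs κ.measurable.aemeasurable]
  exact (integral_toReal (κ.measurable_coe hs).aemeasurable
    (.of_forall fun y => measure_lt_top _ _)).symm

theorem toReal_lintegral_coe_eq_integral_measureReal [IsFiniteMeasure ν] (hu : Measurable u) :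
    (∫⁻ x, (u x : ℝ≥0∞) ∂ν).toReal = ∫ t in Ioi (0 : ℝ), ν.real {x | t < (u x : ℝ)} := by
  rw [lintegral_coe_eq_lintegral_measure_lt hu]
  exact (integral_toReal (antitone_measure_setOf_lt _).measurable.aemeasurable
    (.of_forall fun t => measure_lt_top _ _)).symm

theorem integrableOn_measureReal_lt (hu : Measurable u)
    (hu_int : ∫⁻ x, (u x : ℝ≥0∞) ∂ν ≠ ∞) :
    IntegrableOn (fun t : ℝ => ν.real {x | t < (u x : ℝ)}) (Ioi 0) := by
  rw [lintegral_coe_eq_lintegral_measure_lt hu] at hu_int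
  exact integrable_toReal_of_lintegral_ne_top
    (antitone_measure_setOf_lt _).measurable.aemeasurable hu_int

theorem enorm_toReal_lintegral_sub_le [IsFiniteMeasure ν] {ρ : Measure X} [IsFiniteMeasure ρ]
    (hu : Measurable u) (hν : ∫⁻ x, (u x : ℝ≥0∞) ∂ν ≠ ∞) (hρ : ∫⁻ x, (u x : ℝ≥0∞) ∂ρ ≠ ∞) :
    ‖(∫⁻ x, (u x : ℝ≥0∞) ∂ν).toReal - (∫⁻ x, (u x : ℝ≥0∞) ∂ρ).toReal‖ₑ ≤
      ∫⁻ t in Ioi (0 : ℝ), ‖ν.real {x | t < (u x : ℝ)} - ρ.real {x | t < (u x : ℝ)}‖ₑ := by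
  rw [toReal_lintegral_coe_eq_integral_measureReal hu,
    toReal_lintegral_coe_eq_integral_measureReal hu,
    ← integral_sub (integrableOn_measureReal_lt hu hν) (integrableOn_measureReal_lt hu hρ)]
  exact enorm_integral_le_lintegral_enorm _

theorem measurable_kernel_measureReal_lt [IsMarkovKernel κ] (hu : Measurable u) :
    Measurable fun p : Y × ℝ => (κ p.1).real {x | p.2 < (u x : ℝ)} :=
  (Kernel.measurable_kernel_prodMk_left (κ := κ.prodMkRight ℝ)
    (measurableSet_lt (measurable_snd.comp measurable_fst)
      (hu.coe_nnreal_real.comp measurable_snd))).ennreal_toReal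

theorem measurable_lorentzNorm_kernel [IsMarkovKernel κ] (hu : Measurable u) :
    Measurable fun y => lorentzNorm (κ y) u := by
  simp_rw [lorentzNorm_eq_lintegral_psiZero]
  exact (continuous_psiZero.measurable.comp
    (measurable_kernel_measureReal_lt hu)).ennreal_ofReal.lintegral_prod_right'

theorem ae_lintegral_kernel_lt_top (hu : Measurable u)
    (hu_int : ∫⁻ x, (u x : ℝ≥0∞) ∂(κ ∘ₘ P) ≠ ∞) :
    ∀ᵐ y ∂P, ∫⁻ x, (u x : ℝ≥0∞) ∂κ y < ∞ := by
  rw [Measure.lintegral_bind κ.measurable.aemeasurable hu.coe_nnreal_ennreal.aemeasurable] at hu_int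
  exact ae_lt_top hu.coe_nnreal_ennreal.lintegral_kernel hu_int

theorem lintegral_lorentzNorm_kernel_add_le [IsMarkovKernel κ] [IsProbabilityMeasure P]
    (hu : Measurable u) (hu_int : ∫⁻ x, (u x : ℝ≥0∞) ∂(κ ∘ₘ P) ≠ ∞) (c : ℝ≥0) :
    ∫⁻ y, lorentzNorm (κ y) u ∂P + c * ∫⁻ y,
        ‖(∫⁻ x, (u x : ℝ≥0∞) ∂κ y).toReal - (∫⁻ x, (u x : ℝ≥0∞) ∂(κ ∘ₘ P)).toReal‖ₑ ∂P ≤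
      lorentzNorm (κ ∘ₘ P) u + c ^ 2 * ∫⁻ x, (u x : ℝ≥0∞) ∂(κ ∘ₘ P) := by
  set N : Measure X → ℝ → ℝ := fun ρ t => ρ.real {x | t < (u x : ℝ)}
  have h_mean (t : ℝ) : N (κ ∘ₘ P) t = ∫ y, N (κ y) t ∂P :=
    measureReal_comp (measurableSet_lt measurable_const hu.coe_nnreal_real)
  have hN : Measurable fun p : Y × ℝ => N (κ p.1) p.2 := measurable_kernel_measureReal_lt hu
  have hN' (t : ℝ) : Measurable fun y => N (κ y) t := hN.comp measurable_prodMk_right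
  have hN_mean : Measurable (N (κ ∘ₘ P)) :=
    (antitone_measure_setOf_lt _).measurable.ennreal_toReal
  have hN_psi : Measurable fun p : Y × ℝ => ENNReal.ofReal (psiZero (N (κ p.1) p.2)) :=
    (continuous_psiZero.measurable.comp hN).ennreal_ofReal
  have hN_sub : Measurable fun p : Y × ℝ => ‖N (κ p.1) p.2 - N (κ ∘ₘ P) p.2‖ₑ :=
    (hN.sub (hN_mean.comp measurable_snd)).enorm
  calc ∫⁻ y, lorentzNorm (κ y) u ∂P + c * ∫⁻ y,
        ‖(∫⁻ x, (u x : ℝ≥0∞) ∂κ y).toReal - (∫⁻ x, (u x : ℝ≥0∞) ∂(κ ∘ₘ P)).toReal‖ₑ ∂P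
    _ ≤ ∫⁻ y, (∫⁻ t in Ioi 0, ENNReal.ofReal (psiZero (N (κ y) t))) ∂P +
        c * ∫⁻ y, (∫⁻ t in Ioi 0, ‖N (κ y) t - N (κ ∘ₘ P) t‖ₑ) ∂P := by
      simp_rw [lorentzNorm_eq_lintegral_psiZero]
      refine add_le_add le_rfl (mul_le_mul_right (lintegral_mono_ae ?_) _)
      filter_upwards [ae_lintegral_kernel_lt_top hu hu_int] with y hy
      exact enorm_toReal_lintegral_sub_le hu hy.ne hu_int
    _ = ∫⁻ t in Ioi 0, (∫⁻ y, ENNReal.ofReal (psiZero (N (κ y) t)) ∂P +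
        c * ∫⁻ y, ‖N (κ y) t - N (κ ∘ₘ P) t‖ₑ ∂P) := by
      rw [lintegral_add_left hN_psi.lintegral_prod_left',
        lintegral_const_mul _ hN_sub.lintegral_prod_left',
        lintegral_lintegral_swap (f := fun y t => ENNReal.ofReal (psiZero (N (κ y) t)))
          hN_psi.aemeasurable,
        lintegral_lintegral_swap (f := fun y t => ‖N (κ y) t - N (κ ∘ₘ P) t‖ₑ) hN_sub.aemeasurable]
    _ ≤ ∫⁻ t in Ioi 0, (ENNReal.ofReal (psiZero (N (κ ∘ₘ P) t)) +
        c ^ 2 * ENNReal.ofReal (N (κ ∘ₘ P) t)) := by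
      refine lintegral_mono fun t => ?_
      simp_rw [h_mean]
      exact lintegral_psiZero_add_le (hN' t) (fun y => measureReal_mem_Icc _) c
    _ = lorentzNorm (κ ∘ₘ P) u + c ^ 2 * ∫⁻ x, (u x : ℝ≥0∞) ∂(κ ∘ₘ P) := by
      rw [lintegral_add_right _ (hN_mean.ennreal_ofReal.const_mul _),
        lintegral_const_mul _ hN_mean.ennreal_ofReal, lorentzNorm_eq_lintegral_psiZero,
        lintegral_coe_eq_lintegral_measure_lt hu]
      simp_rw [N, ofReal_measureReal (measure_ne_top _ _)]

theorem add_sq_div_le_of_forall_add_mul_le {a b d v : ℝ≥0∞} (hv : v ≠ ∞)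
    (h : ∀ c : ℝ≥0, a + c * d ≤ b + c ^ 2 * v) : a + d ^ 2 / (4 * v) ≤ b := by
  rcases eq_or_ne b ∞ with rfl | hb
  · exact le_top
  have h_sum : a + d ≠ ∞ := ne_top_of_le_ne_top (ENNReal.add_ne_top.2 ⟨hb, hv⟩) (by simpa using h 1)
  lift a to ℝ≥0 using (ENNReal.add_ne_top.1 h_sum).1
  lift d to ℝ≥0 using (ENNReal.add_ne_top.1 h_sum).2
  lift b to ℝ≥0 using hb
  lift v to ℝ≥0 using hv
  have h_real (c : ℝ≥0) : (a : ℝ) + c * d ≤ b + c ^ 2 * v := by exact_mod_cast h c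
  rcases eq_or_ne v 0 with rfl | hv
  · have hd : d = 0 := by
      by_contra hd
      have := h_real ((b + 1) / d)
      have hd' : (d : ℝ) ≠ 0 := by exact_mod_cast hd
      push_cast at this
      rw [div_mul_cancel₀ _ hd'] at this
      linarith [a.coe_nonneg]
    simpa [hd] using h 0
  · have : (0 : ℝ) < v := by positivity
    have h_opt := h_real (d / (2 * v))
    rw [show (4 : ℝ≥0∞) * v = ((4 * v : ℝ≥0) : ℝ≥0∞) by push_cast; rfl, ← ENNReal.coe_pow,
      ← ENNReal.coe_div (by positivity), ← ENNReal.coe_add, ENNReal.coe_le_coe,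
      ← NNReal.coe_le_coe]
    push_cast at h_opt ⊢
    have h_left : (d : ℝ) / (2 * v) * d = 2 * (d ^ 2 / (4 * v)) := by field_simp; norm_num
    have h_right : ((d : ℝ) / (2 * v)) ^ 2 * v = d ^ 2 / (4 * v) := by field_simp; norm_num
    linarith

theorem lintegral_lorentzNorm_kernel_add_sq_div_le [IsMarkovKernel κ] [IsProbabilityMeasure P]
    (hu : Measurable u) (hu_int : ∫⁻ x, (u x : ℝ≥0∞) ∂(κ ∘ₘ P) ≠ ∞) :
    ∫⁻ y, lorentzNorm (κ y) u ∂P + (∫⁻ y, ‖(∫⁻ x, (u x : ℝ≥0∞) ∂κ y).toReal -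
        (∫⁻ x, (u x : ℝ≥0∞) ∂(κ ∘ₘ P)).toReal‖ₑ ∂P) ^ 2 / (4 * ∫⁻ x, (u x : ℝ≥0∞) ∂(κ ∘ₘ P)) ≤
      lorentzNorm (κ ∘ₘ P) u :=
  add_sq_div_le_of_forall_add_mul_le hu_int (lintegral_lorentzNorm_kernel_add_le hu hu_int)

end LorentzConcavity

section Profile

theorem setLIntegral_Ioc_add_mul_le_of_antitoneOn {k : ℝ → ℝ≥0∞} {a r s : ℝ}
    (hk : AntitoneOn k (Ici a)) (ha : 0 ≤ a) (hr : a ≤ r) (hs : a ≤ s) :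
    (∫⁻ t in Ioc a s, k t) + ENNReal.ofReal r * k r ≤
      (∫⁻ t in Ioc a r, k t) + ENNReal.ofReal s * k r := by
  have h_split {p q : ℝ} (hp : a ≤ p) (hpq : p ≤ q) :
      ∫⁻ t in Ioc a q, k t = (∫⁻ t in Ioc a p, k t) + ∫⁻ t in Ioc p q, k t := by
    rw [← Ioc_union_Ioc_eq_Ioc hp hpq,
      lintegral_union measurableSet_Ioc (Ioc_disjoint_Ioc_of_le le_rfl)]
  have h_ofReal {p q : ℝ} (hp : a ≤ p) (hpq : p ≤ q) :
      ENNReal.ofReal q * k r = ENNReal.ofReal p * k r + ∫⁻ _ in Ioc p q, k r := by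
    rw [setLIntegral_const, Real.volume_Ioc, mul_comm (k r), ← add_mul,
      ← ENNReal.ofReal_add (ha.trans hp) (sub_nonneg.2 hpq), add_sub_cancel]
  rcases le_total r s with hrs | hsr
  · have h_le : ∫⁻ t in Ioc r s, k t ≤ ∫⁻ _ in Ioc r s, k r :=
      setLIntegral_mono' measurableSet_Ioc fun t ht => hk hr (hr.trans ht.1.le) ht.1.le
    rw [h_split hr hrs, h_ofReal hr hrs, add_right_comm, add_assoc]
    gcongr
  · have h_le : ∫⁻ _ in Ioc s r, k r ≤ ∫⁻ t in Ioc s r, k t :=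
      setLIntegral_mono' measurableSet_Ioc fun t ht => hk (hs.trans ht.1.le) hr ht.2
    rw [h_split hs hsr, h_ofReal hs hsr, add_assoc, add_comm (∫⁻ t in Ioc s r, k t)]
    gcongr

/-- The density `1 / (t α(t))` of the integral in `bumpConst α`, that is, the slope of
`bumpProfile α` at `t`. -/
noncomputable def bumpSlope (α : ℝ → ℝ≥0) (t : ℝ) : ℝ≥0∞ :=
  (ENNReal.ofReal t * (α t : ℝ≥0∞))⁻¹

/-- The increasing concave profile `r ↦ C_α + ∫₁^r dt / (t α(t))` on `[1, ∞]`. -/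
noncomputable def bumpProfile (α : ℝ → ℝ≥0) (r : ℝ≥0∞) : ℝ≥0∞ :=
  bumpConst α + ∫⁻ t in {t : ℝ | 1 < t ∧ ENNReal.ofReal t ≤ r}, bumpSlope α t

/-- The perspective `(u, w) ↦ u g(w / u)` of the concave profile `g = bumpProfile α`; like every
perspective of a concave function it is concave and positively homogeneous in both variables. -/
noncomputable def bumpPerspective (α : ℝ → ℝ≥0) (u w : ℝ≥0∞) : ℝ≥0∞ :=
  u * bumpProfile α (w / u)

variable {α : ℝ → ℝ≥0}

theorem bumpConst_ne_zero : bumpConst α ≠ 0 :=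
  (lt_of_lt_of_le (ENNReal.inv_pos.2 ENNReal.coe_ne_top) le_self_add).ne'

theorem one_le_bumpConst_mul (hC : bumpConst α ≠ ∞) : 1 ≤ bumpConst α * α 1 := by
  have h_inv_le : (α 1 : ℝ≥0∞)⁻¹ ≤ bumpConst α := le_self_add
  have h_ne_zero : (α 1 : ℝ≥0∞) ≠ 0 := ENNReal.inv_ne_top.1 (ne_top_of_le_ne_top hC h_inv_le)
  rw [← ENNReal.inv_mul_cancel h_ne_zero ENNReal.coe_ne_top]
  gcongr

theorem coe_ne_zero_of_one_le (hα : MonotoneOn α (Ici 1)) (hC : bumpConst α ≠ ∞) {r : ℝ}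
    (hr : 1 ≤ r) : (α r : ℝ≥0∞) ≠ 0 := by
  have h_one : α 1 ≠ 0 := fun h => by simpa [h] using one_le_bumpConst_mul hC
  exact ENNReal.coe_ne_zero.2 ((pos_of_ne_zero h_one).trans_le (hα self_mem_Ici hr hr)).ne'

theorem antitoneOn_bumpSlope (hα : MonotoneOn α (Ici 1)) : AntitoneOn (bumpSlope α) (Ici 1) :=
  fun _ hr _ hs hrs => ENNReal.inv_le_inv.2 <|
    mul_le_mul' (ENNReal.ofReal_le_ofReal hrs) (ENNReal.coe_le_coe.2 (hα hr hs hrs))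

theorem bumpSlope_ne_zero (r : ℝ) : bumpSlope α r ≠ 0 :=
  ENNReal.inv_ne_zero.2 (ENNReal.mul_ne_top ENNReal.ofReal_ne_top ENNReal.coe_ne_top)

theorem bumpSlope_ne_top (hα : MonotoneOn α (Ici 1)) (hC : bumpConst α ≠ ∞) {r : ℝ}
    (hr : 1 ≤ r) : bumpSlope α r ≠ ∞ :=
  ENNReal.inv_ne_top.2 (mul_ne_zero (ENNReal.ofReal_pos.2 (zero_lt_one.trans_le hr)).ne'
    (coe_ne_zero_of_one_le hα hC hr))

theorem monotone_bumpProfile : Monotone (bumpProfile α) :=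
  fun r s hrs =>
    have h_subset : {t : ℝ | 1 < t ∧ ENNReal.ofReal t ≤ r} ⊆ {t | 1 < t ∧ ENNReal.ofReal t ≤ s} :=
      fun _ ht => ⟨ht.1, ht.2.trans hrs⟩
    add_le_add_right (lintegral_mono_set h_subset) _

theorem bumpConst_le_bumpProfile (r : ℝ≥0∞) : bumpConst α ≤ bumpProfile α r :=
  le_self_add

theorem bumpProfile_le (r : ℝ≥0∞) : bumpProfile α r ≤ 2 * bumpConst α := by
  have h_subset : {t : ℝ | 1 < t ∧ ENNReal.ofReal t ≤ r} ⊆ Ioi 1 := fun _ ht => ht.1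
  rw [two_mul]
  exact add_le_add_right ((lintegral_mono_set h_subset).trans le_add_self) _

theorem bumpProfile_ofReal {r : ℝ} (hr : 1 ≤ r) :
    bumpProfile α (ENNReal.ofReal r) = bumpConst α + ∫⁻ t in Ioc 1 r, bumpSlope α t := by
  have h_Ioc : {t : ℝ | 1 < t ∧ ENNReal.ofReal t ≤ ENNReal.ofReal r} = Ioc 1 r := by
    ext t
    exact and_congr_right fun _ => ENNReal.ofReal_le_ofReal_iff (zero_le_one.trans hr)
  rw [bumpProfile, h_Ioc]

theorem bumpProfile_add_mul_le (hα : MonotoneOn α (Ici 1)) {r : ℝ} {s : ℝ≥0∞}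
    (hr : 1 ≤ r) (hs : 1 ≤ s) :
    bumpProfile α s + ENNReal.ofReal r * bumpSlope α r ≤
      bumpProfile α (ENNReal.ofReal r) + s * bumpSlope α r := by
  rcases eq_or_ne s ∞ with rfl | hs_top
  · simp [ENNReal.top_mul (bumpSlope_ne_zero r)]
  · have hs_one : 1 ≤ s.toReal := by simpa using ENNReal.toReal_mono hs_top hs
    rw [← ENNReal.ofReal_toReal hs_top, bumpProfile_ofReal hr, bumpProfile_ofReal hs_one,
      add_assoc, add_assoc]
    exact add_le_add_right (setLIntegral_Ioc_add_mul_le_of_antitoneOn (antitoneOn_bumpSlope hα)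
      zero_le_one hr hs_one) _

theorem mul_bumpConst_le_bumpPerspective (u w : ℝ≥0∞) :
    u * bumpConst α ≤ bumpPerspective α u w :=
  mul_le_mul_right (bumpConst_le_bumpProfile _) u

theorem bumpPerspective_le (u w : ℝ≥0∞) : bumpPerspective α u w ≤ u * (2 * bumpConst α) :=
  mul_le_mul_right (bumpProfile_le _) u

theorem bumpPerspective_add_mul_le (hα : MonotoneOn α (Ici 1)) {r : ℝ} {u w : ℝ≥0∞} (hr : 1 ≤ r)
    (hu : u ≠ ∞) (huw : u ≤ w) :
    bumpPerspective α u w + u * (ENNReal.ofReal r * bumpSlope α r) ≤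
      u * bumpProfile α (ENNReal.ofReal r) + w * bumpSlope α r := by
  rcases eq_or_ne u 0 with rfl | hu_zero
  · simp [bumpPerspective]
  · have h_one_le : 1 ≤ w / u := (ENNReal.le_div_iff_mul_le (.inl hu_zero) (.inl hu)).2 (by simpa)
    calc bumpPerspective α u w + u * (ENNReal.ofReal r * bumpSlope α r)
      _ = u * (bumpProfile α (w / u) + ENNReal.ofReal r * bumpSlope α r) := by
        rw [bumpPerspective, mul_add]
      _ ≤ u * (bumpProfile α (ENNReal.ofReal r) + w / u * bumpSlope α r) :=
        mul_le_mul_right (bumpProfile_add_mul_le hα hr h_one_le) u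
      _ = u * bumpProfile α (ENNReal.ofReal r) + w * bumpSlope α r := by
        rw [mul_add, ← mul_assoc u (w / u), ENNReal.mul_div_cancel hu_zero hu]

variable {Ω : Type*} [MeasurableSpace Ω] {P : Measure Ω} {U W : Ω → ℝ≥0∞}

theorem aemeasurable_bumpPerspective (hU : AEMeasurable U P) (hW : AEMeasurable W P) :
    AEMeasurable (fun y => bumpPerspective α (U y) (W y)) P :=
  hU.mul (monotone_bumpProfile.measurable.comp_aemeasurable (hW.div hU))

theorem lintegral_bumpPerspective_le_top (hu : ∫⁻ y, U y ∂P ≠ ∞) (hC : bumpConst α ≠ ∞) :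
    ∫⁻ y, bumpPerspective α (U y) (W y) ∂P ≤ bumpPerspective α (∫⁻ y, U y ∂P) ∞ := by
  rw [bumpPerspective, ENNReal.top_div_of_ne_top hu]
  calc ∫⁻ y, bumpPerspective α (U y) (W y) ∂P ≤ ∫⁻ y, U y * bumpProfile α ∞ ∂P :=
        lintegral_mono fun y => mul_le_mul_right (monotone_bumpProfile le_top) _
    _ = (∫⁻ y, U y ∂P) * bumpProfile α ∞ :=
        lintegral_mul_const' _ _ (ne_top_of_le_ne_top (by finiteness) (bumpProfile_le _))

theorem lintegral_bumpPerspective_add_le (hα : MonotoneOn α (Ici 1)) (hC : bumpConst α ≠ ∞)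
    (hU : AEMeasurable U P) (hUW : U ≤ᵐ[P] W) {w δ : ℝ≥0∞}
    (hu_zero : ∫⁻ y, U y ∂P ≠ 0) (hw_top : w ≠ ∞) (hw : ∫⁻ y, W y ∂P + δ ≤ w) :
    ∫⁻ y, bumpPerspective α (U y) (W y) ∂P + δ * bumpSlope α (w / ∫⁻ y, U y ∂P).toReal ≤
      bumpPerspective α (∫⁻ y, U y ∂P) w := by
  have hu_le : ∫⁻ y, U y ∂P ≤ w := (lintegral_mono_ae hUW).trans (le_self_add.trans hw)
  set u := ∫⁻ y, U y ∂P with hu_def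
  have hu_top : u ≠ ∞ := ne_top_of_le_ne_top hw_top hu_le
  have hr_top : w / u ≠ ∞ := ENNReal.div_ne_top hw_top hu_zero
  have h_one_le : 1 ≤ w / u :=
    (ENNReal.le_div_iff_mul_le (.inl hu_zero) (.inl hu_top)).2 (by simpa)
  have hr : 1 ≤ (w / u).toReal := by simpa using ENNReal.toReal_mono hr_top h_one_le
  set k := bumpSlope α (w / u).toReal
  have hk : k ≠ ∞ := bumpSlope_ne_top hα hC hr
  have h_profile : bumpProfile α (w / u) ≠ ∞ :=
    ne_top_of_le_ne_top (by finiteness) (bumpProfile_le _)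
  have h_tangent : ∫⁻ y, bumpPerspective α (U y) (W y) ∂P + w * k ≤
      bumpPerspective α u w + (∫⁻ y, W y ∂P) * k :=
    calc ∫⁻ y, bumpPerspective α (U y) (W y) ∂P + w * k
      _ = ∫⁻ y, (bumpPerspective α (U y) (W y) + U y * (w / u * k)) ∂P := by
        rw [lintegral_add_right' _ (hU.mul_const _), lintegral_mul_const' _ _ (by finiteness),
          ← hu_def, ← mul_assoc, ENNReal.mul_div_cancel hu_zero hu_top]
      _ ≤ ∫⁻ y, (U y * bumpProfile α (w / u) + W y * k) ∂P := by
        refine lintegral_mono_ae ?_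
        filter_upwards [hUW, ae_lt_top' hU hu_top] with y hUW_y hU_y
        simpa only [ENNReal.ofReal_toReal hr_top] using
          bumpPerspective_add_mul_le hα hr hU_y.ne hUW_y
      _ = bumpPerspective α u w + (∫⁻ y, W y ∂P) * k := by
        rw [lintegral_add_left' (hU.mul_const _), lintegral_mul_const' _ _ h_profile,
          lintegral_mul_const' _ _ hk]
        rfl
  refine (ENNReal.add_le_add_iff_right (ENNReal.mul_ne_top hw_top hk)).1 ?_
  calc ∫⁻ y, bumpPerspective α (U y) (W y) ∂P + δ * k + w * k
    _ ≤ bumpPerspective α u w + (∫⁻ y, W y ∂P) * k + δ * k := by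
      rw [add_right_comm]
      gcongr
    _ = bumpPerspective α u w + (∫⁻ y, W y ∂P + δ) * k := by rw [add_assoc, ← add_mul]
    _ ≤ bumpPerspective α u w + w * k := by gcongr

end Profile

section EntropyBump

open ProbabilityTheory

variable {X Y : Type*} [MeasurableSpace X] [MeasurableSpace Y] {α : ℝ → ℝ≥0} {u : X → ℝ≥0}

theorem entropyBump_of_ne_top {ν : Measure X} (h : lorentzNorm ν u ≠ ∞) :
    entropyBump α ν u =
      α (lorentzNorm ν u / ∫⁻ x, (u x : ℝ≥0∞) ∂ν).toReal * lorentzNorm ν u :=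
  if_neg h

theorem entropyBump_of_eq_top {ν : Measure X} (h : lorentzNorm ν u = ∞) :
    entropyBump α ν u = ∞ :=
  if_pos h

theorem lintegral_le_bumpConst_mul_entropyBump {ν : Measure X} [IsProbabilityMeasure ν]
    (hα : MonotoneOn α (Ici 1)) (hC : bumpConst α ≠ ∞) (hu : Measurable u) :
    ∫⁻ x, (u x : ℝ≥0∞) ∂ν ≤ bumpConst α * entropyBump α ν u := by
  have h_le := lintegral_le_lorentzNorm (ν := ν) hu
  rcases eq_or_ne (lorentzNorm ν u) ∞ with h_top | h_top
  · rw [entropyBump_of_eq_top h_top, ENNReal.mul_top bumpConst_ne_zero]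
    exact le_top
  rcases eq_or_ne (∫⁻ x, (u x : ℝ≥0∞) ∂ν) 0 with h_zero | h_zero
  · simp [h_zero]
  set r := lorentzNorm ν u / ∫⁻ x, (u x : ℝ≥0∞) ∂ν
  have h_one_le : 1 ≤ r := (ENNReal.le_div_iff_mul_le (.inl h_zero)
    (.inl (ne_top_of_le_ne_top h_top h_le))).2 (by simpa)
  have hr_top : r ≠ ∞ := ENNReal.div_ne_top h_top h_zero
  have hr : 1 ≤ r.toReal := by simpa using ENNReal.toReal_mono hr_top h_one_le
  calc ∫⁻ x, (u x : ℝ≥0∞) ∂ν ≤ 1 * lorentzNorm ν u := by rwa [one_mul]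
    _ ≤ bumpConst α * α r.toReal * lorentzNorm ν u := by
      gcongr
      exact (one_le_bumpConst_mul hC).trans
        (mul_le_mul_right (ENNReal.coe_le_coe.2 (hα self_mem_Ici hr hr)) _)
    _ = bumpConst α * entropyBump α ν u := by rw [entropyBump_of_ne_top h_top, mul_assoc]

theorem div_lintegral_mul_bumpSlope {ν : Measure X} (h_top : lorentzNorm ν u ≠ ∞)
    (hu_zero : ∫⁻ x, (u x : ℝ≥0∞) ∂ν ≠ 0) (hu_top : ∫⁻ x, (u x : ℝ≥0∞) ∂ν ≠ ∞) (d : ℝ≥0∞) :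
    d / (4 * ∫⁻ x, (u x : ℝ≥0∞) ∂ν) *
        bumpSlope α (lorentzNorm ν u / ∫⁻ x, (u x : ℝ≥0∞) ∂ν).toReal =
      d / (4 * entropyBump α ν u) := by
  rw [entropyBump_of_ne_top h_top, bumpSlope,
    ENNReal.ofReal_toReal (ENNReal.div_ne_top h_top hu_zero)]
  set v := ∫⁻ x, (u x : ℝ≥0∞) ∂ν
  set w := lorentzNorm ν u
  set a : ℝ≥0∞ := ((α (w / v).toReal : ℝ≥0) : ℝ≥0∞)
  have h_cancel : 4 * v * (w / v * a) = 4 * (a * w) := by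
    rw [mul_assoc, ← mul_assoc v, ENNReal.mul_div_cancel hu_zero hu_top, mul_comm w]
  rw [← h_cancel, div_eq_mul_inv d, div_eq_mul_inv d, mul_assoc, ENNReal.mul_inv
    (.inl (mul_ne_zero four_ne_zero hu_zero)) (.inl (ENNReal.mul_ne_top (by simp) hu_top))]

theorem lintegral_bumpPerspective_kernel_add_le {κ : Kernel Y X} [IsMarkovKernel κ]
    {P : Measure Y} [IsProbabilityMeasure P] (hα : MonotoneOn α (Ici 1)) (hC : bumpConst α ≠ ∞)
    (hu : Measurable u) (hu_zero : ∫⁻ x, (u x : ℝ≥0∞) ∂(κ ∘ₘ P) ≠ 0)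
    (hu_top : ∫⁻ x, (u x : ℝ≥0∞) ∂(κ ∘ₘ P) ≠ ∞) :
    ∫⁻ y, bumpPerspective α (∫⁻ x, (u x : ℝ≥0∞) ∂κ y) (lorentzNorm (κ y) u) ∂P +
        (∫⁻ y, ‖(∫⁻ x, (u x : ℝ≥0∞) ∂κ y).toReal -
          (∫⁻ x, (u x : ℝ≥0∞) ∂(κ ∘ₘ P)).toReal‖ₑ ∂P) ^ 2 / (4 * entropyBump α (κ ∘ₘ P) u) ≤
      bumpPerspective α (∫⁻ x, (u x : ℝ≥0∞) ∂(κ ∘ₘ P)) (lorentzNorm (κ ∘ₘ P) u) := by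
  have h_bind : ∫⁻ x, (u x : ℝ≥0∞) ∂(κ ∘ₘ P) = ∫⁻ y, ∫⁻ x, (u x : ℝ≥0∞) ∂κ y ∂P :=
    Measure.lintegral_bind κ.measurable.aemeasurable hu.coe_nnreal_ennreal.aemeasurable
  rcases eq_or_ne (lorentzNorm (κ ∘ₘ P) u) ∞ with h_top | h_top
  · simp only [entropyBump_of_eq_top h_top, ENNReal.mul_top four_ne_zero, ENNReal.div_top, add_zero,
      h_top]
    rw [h_bind] at hu_top ⊢
    exact lintegral_bumpPerspective_le_top hu_top hC
  · have h_concave := lintegral_lorentzNorm_kernel_add_sq_div_le hu hu_top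
    rw [← div_lintegral_mul_bumpSlope h_top hu_zero hu_top]
    rw [h_bind] at hu_zero h_concave ⊢
    exact lintegral_bumpPerspective_add_le hα hC hu.coe_nnreal_ennreal.lintegral_kernel.aemeasurable
      (.of_forall fun y => lintegral_le_lorentzNorm hu) hu_zero h_top h_concave

end EntropyBump

section Jensen

variable {Ω E : Type*} [MeasurableSpace Ω] {P : Measure Ω} [NormedAddCommGroup E]

theorem enorm_le_sq_div_add (x : E) {v : ℝ≥0∞} (hv : v ≠ ∞) : ‖x‖ₑ ≤ ‖x‖ₑ ^ 2 / v + v := by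
  rcases le_total ‖x‖ₑ v with h | h
  · exact h.trans le_add_self
  · refine le_add_right ?_
    rcases eq_or_ne v 0 with rfl | hv_zero
    · rcases eq_or_ne x 0 with rfl | hx
      · simp
      · simp [ENNReal.div_zero, hx]
    · rw [ENNReal.le_div_iff_mul_le (.inl hv_zero) (.inl hv), sq]
      gcongr

theorem integrable_of_lintegral_sq_div_ne_top {x : Ω → E} {v : Ω → ℝ≥0∞}
    (hx : AEStronglyMeasurable x P) (hv : AEMeasurable v P) (hv_top : ∫⁻ y, v y ∂P ≠ ∞)
    (h_energy : ∫⁻ y, ‖x y‖ₑ ^ 2 / v y ∂P ≠ ∞) : Integrable x P := by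
  refine ⟨hx, ?_⟩
  calc ∫⁻ y, ‖x y‖ₑ ∂P ≤ ∫⁻ y, (‖x y‖ₑ ^ 2 / v y + v y) ∂P := by
        refine lintegral_mono_ae ?_
        filter_upwards [ae_lt_top' hv hv_top] with y hy using enorm_le_sq_div_add _ hy.ne
    _ = ∫⁻ y, ‖x y‖ₑ ^ 2 / v y ∂P + ∫⁻ y, v y ∂P := lintegral_add_right' _ hv
    _ < ∞ := ENNReal.add_lt_top.2 ⟨h_energy.lt_top, hv_top.lt_top⟩

theorem ae_eq_zero_of_lintegral_sq_div_ne_top {x : Ω → E} {v : Ω → ℝ≥0∞}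
    (hx : AEStronglyMeasurable x P) (hv : AEMeasurable v P)
    (h_energy : ∫⁻ y, ‖x y‖ₑ ^ 2 / v y ∂P ≠ ∞) : ∀ᵐ y ∂P, v y = 0 → x y = 0 := by
  filter_upwards [ae_lt_top' ((hx.enorm.pow_const 2).div hv) h_energy] with y hy hv_y
  by_contra hx_y
  simp [hv_y, ENNReal.div_zero, hx_y] at hy

variable [InnerProductSpace ℝ E]

/-- The difference of the two sides is `(‖x - v • l‖ - k v) ^ 2 / v`. -/
theorem two_mul_inner_add_two_mul_norm_sub_le (x l : E) (k : ℝ) {v : ℝ} (hv : 0 ≤ v)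
    (hx : v = 0 → x = 0) :
    2 * inner ℝ l x - ‖l‖ ^ 2 * v + (2 * k * ‖x - v • l‖ - k ^ 2 * v) ≤ ‖x‖ ^ 2 / v := by
  rcases hv.eq_or_lt' with rfl | hv_pos
  · simp [hx rfl]
  · have h_sq : ‖x - v • l‖ ^ 2 = ‖x‖ ^ 2 - 2 * (v * inner ℝ l x) + v ^ 2 * ‖l‖ ^ 2 := by
      rw [norm_sub_sq_real, inner_smul_right, real_inner_comm, norm_smul, mul_pow,
        Real.norm_eq_abs, sq_abs]
    rw [le_div_iff₀ hv_pos]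
    linarith [sq_nonneg (‖x - v • l‖ - k * v)]

variable [CompleteSpace E]

theorem norm_integral_sq_div_add_sq_div_le {x : Ω → E} {v : Ω → ℝ} (hx : Integrable x P)
    (hv : Integrable v P) (hv_nonneg : 0 ≤ᵐ[P] v) (hxv : ∀ᵐ y ∂P, v y = 0 → x y = 0)
    (h_energy : Integrable (fun y => ‖x y‖ ^ 2 / v y) P) :
    ‖∫ y, x y ∂P‖ ^ 2 / ∫ y, v y ∂P +
        (∫ y, ‖x y - v y • (∫ y, v y ∂P)⁻¹ • ∫ y, x y ∂P‖ ∂P) ^ 2 / ∫ y, v y ∂P ≤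
      ∫ y, ‖x y‖ ^ 2 / v y ∂P := by
  rcases (integral_nonneg_of_ae hv_nonneg).eq_or_lt' with h_zero | h_pos
  · rw [h_zero, div_zero, div_zero, add_zero]
    refine integral_nonneg_of_ae (hv_nonneg.mono fun y hy => ?_)
    exact div_nonneg (sq_nonneg _) hy
  set v₀ := ∫ y, v y ∂P with hv₀
  set x₀ := ∫ y, x y ∂P with hx₀
  set l := v₀⁻¹ • x₀ with hl
  set e := ∫ y, ‖x y - v y • l‖ ∂P with he
  set k := e / v₀
  have h_norm : Integrable (fun y => ‖x y - v y • l‖) P := (hx.sub (hv.smul_const l)).norm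
  have h_inner : Integrable (fun y => 2 * inner ℝ l (x y) - ‖l‖ ^ 2 * v y) P :=
    ((hx.const_inner l).const_mul 2).sub (hv.const_mul _)
  have h_var : Integrable (fun y => 2 * k * ‖x y - v y • l‖ - k ^ 2 * v y) P :=
    (h_norm.const_mul _).sub (hv.const_mul _)
  calc ‖x₀‖ ^ 2 / v₀ + e ^ 2 / v₀
    _ = 2 * inner ℝ l x₀ - ‖l‖ ^ 2 * v₀ + (2 * k * e - k ^ 2 * v₀) := by
      rw [hl, real_inner_smul_left, real_inner_self_eq_norm_sq, norm_smul, mul_pow,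
        Real.norm_eq_abs, sq_abs]
      simp only [k]
      field_simp
      ring
    _ = ∫ y, (2 * inner ℝ l (x y) - ‖l‖ ^ 2 * v y +
          (2 * k * ‖x y - v y • l‖ - k ^ 2 * v y)) ∂P := by
      rw [integral_add h_inner h_var, integral_sub ((hx.const_inner l).const_mul 2)
        (hv.const_mul _), integral_sub (h_norm.const_mul _) (hv.const_mul _)]
      simp only [integral_const_mul, integral_inner hx, ← hv₀, ← hx₀, ← he]
    _ ≤ ∫ y, ‖x y‖ ^ 2 / v y ∂P := by
      refine integral_mono_ae (h_inner.add h_var) h_energy ?_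
      filter_upwards [hv_nonneg, hxv] with y hy hxy
      exact two_mul_inner_add_two_mul_norm_sub_le (x y) l k hy hxy

theorem enorm_integral_sq_div_add_sq_div_le {x : Ω → E} {v : Ω → ℝ≥0∞}
    (hx : AEStronglyMeasurable x P) (hv : AEMeasurable v P) (hv_zero : ∫⁻ y, v y ∂P ≠ 0)
    (hv_top : ∫⁻ y, v y ∂P ≠ ∞) :
    ‖∫ y, x y ∂P‖ₑ ^ 2 / ∫⁻ y, v y ∂P +
        (∫⁻ y, ‖x y - (v y).toReal • (∫⁻ y, v y ∂P).toReal⁻¹ • ∫ y, x y ∂P‖ₑ ∂P) ^ 2 /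
          ∫⁻ y, v y ∂P ≤
      ∫⁻ y, ‖x y‖ₑ ^ 2 / v y ∂P := by
  rcases eq_or_ne (∫⁻ y, ‖x y‖ₑ ^ 2 / v y ∂P) ∞ with h_top | h_energy
  · exact h_top ▸ le_top
  have hx_int := integrable_of_lintegral_sq_div_ne_top hx hv hv_top h_energy
  have hv_int := integrable_toReal_of_lintegral_ne_top hv hv_top
  have h_toReal (y : Ω) : (‖x y‖ₑ ^ 2 / v y).toReal = ‖x y‖ ^ 2 / (v y).toReal := by
    simp
  have h_aemeasurable : AEMeasurable (fun y => ‖x y‖ₑ ^ 2 / v y) P :=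
    (hx.enorm.pow_const 2).div hv
  have h_energy_int : Integrable (fun y => ‖x y‖ ^ 2 / (v y).toReal) P := by
    simpa only [h_toReal] using integrable_toReal_of_lintegral_ne_top h_aemeasurable h_energy
  have h_vanish : ∀ᵐ y ∂P, (v y).toReal = 0 → x y = 0 := by
    filter_upwards [ae_eq_zero_of_lintegral_sq_div_ne_top hx hv h_energy, ae_lt_top' hv hv_top]
      with y hxy hy h_zero
    exact hxy (((ENNReal.toReal_eq_zero_iff _).1 h_zero).resolve_right hy.ne)
  have h_real := norm_integral_sq_div_add_sq_div_le hx_int hv_int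
    (.of_forall fun y => ENNReal.toReal_nonneg) h_vanish h_energy_int
  have h_sub_int : Integrable
      (fun y => x y - (v y).toReal • (∫⁻ y, v y ∂P).toReal⁻¹ • ∫ y, x y ∂P) P :=
    hx_int.sub (hv_int.smul_const _)
  have h_pos : 0 < (∫⁻ y, v y ∂P).toReal := ENNReal.toReal_pos hv_zero hv_top
  rw [integral_toReal hv (ae_lt_top' hv hv_top)] at h_real
  simp only [← h_toReal] at h_real
  rw [integral_toReal h_aemeasurable (ae_lt_top' h_aemeasurable h_energy)] at h_real
  rw [← ofReal_integral_norm_eq_lintegral_enorm h_sub_int,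
    ← ofReal_norm, ← ENNReal.ofReal_toReal hv_top, ← ENNReal.ofReal_toReal h_energy,
    ENNReal.toReal_ofReal h_pos.le, ← ENNReal.ofReal_pow (norm_nonneg _),
    ← ENNReal.ofReal_pow (by positivity), ← ENNReal.ofReal_div_of_pos h_pos,
    ← ENNReal.ofReal_div_of_pos h_pos, ← ENNReal.ofReal_add (by positivity) (by positivity)]
  exact ENNReal.ofReal_le_ofReal h_real

theorem enorm_integral_sq_div_le {x : Ω → E} {v : Ω → ℝ≥0∞}
    (hx : AEStronglyMeasurable x P) (hv : AEMeasurable v P) (hv_top : ∫⁻ y, v y ∂P ≠ ∞) :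
    ‖∫ y, x y ∂P‖ₑ ^ 2 / ∫⁻ y, v y ∂P ≤ ∫⁻ y, ‖x y‖ₑ ^ 2 / v y ∂P := by
  rcases eq_or_ne (∫⁻ y, v y ∂P) 0 with h_zero | h_zero
  · rcases eq_or_ne (∫⁻ y, ‖x y‖ₑ ^ 2 / v y ∂P) ∞ with h_top | h_energy
    · exact h_top ▸ le_top
    · have hx_zero : x =ᵐ[P] 0 := by
        filter_upwards [ae_eq_zero_of_lintegral_sq_div_ne_top hx hv h_energy,
          (lintegral_eq_zero_iff' hv).1 h_zero] with y hxy hy using hxy hy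
      simp [integral_eq_zero_of_ae hx_zero]
  · exact le_self_add.trans (enorm_integral_sq_div_add_sq_div_le hx hv h_zero hv_top)

end Jensen

section Bellman

theorem div_add_div_sq_mul_le {q v v₀ δ : ℝ≥0∞} (hv₀ : v₀ ≠ 0) (hv₀_top : v₀ ≠ ∞)
    (h : v + δ ≤ v₀) : q / v₀ + q / v₀ ^ 2 * δ ≤ q / v := by
  have hv_le : v ≤ v₀ := le_self_add.trans h
  rcases eq_or_ne v 0 with rfl | hv
  · rcases eq_or_ne q 0 with rfl | hq
    · simp
    · simp [ENNReal.div_zero hq]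
  rw [ENNReal.le_div_iff_mul_le (.inl hv) (.inl (ne_top_of_le_ne_top hv₀_top hv_le))]
  have h_sq : v₀ ^ 2 ≠ ∞ := ENNReal.pow_ne_top hv₀_top
  calc (q / v₀ + q / v₀ ^ 2 * δ) * v
    _ = q / v₀ ^ 2 * (v₀ * v + δ * v) := by
      have h_div : q / v₀ = q / v₀ ^ 2 * v₀ := by
        rw [sq, div_eq_mul_inv, div_eq_mul_inv, ENNReal.mul_inv (.inl hv₀) (.inl hv₀_top),
          mul_assoc, mul_assoc, ENNReal.inv_mul_cancel hv₀ hv₀_top, mul_one]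
      rw [h_div]
      ring
    _ ≤ q / v₀ ^ 2 * (v₀ * v₀) := by
      refine mul_le_mul_right ?_ _
      calc v₀ * v + δ * v ≤ v₀ * v + v₀ * δ := by rw [mul_comm δ]; gcongr
        _ = v₀ * (v + δ) := (mul_add _ _ _).symm
        _ ≤ v₀ * v₀ := mul_le_mul_right h v₀
    _ = q := by rw [← sq, ENNReal.div_mul_cancel (pow_ne_zero 2 hv₀) h_sq]

theorem add_sq_le_two_mul_add_sq (a b : ℝ≥0∞) : (a + b) ^ 2 ≤ 2 * a ^ 2 + 2 * b ^ 2 := by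
  have h := ENNReal.rpow_add_le_mul_rpow_add_rpow a b one_le_two
  norm_num [mul_add] at h
  exact h

theorem inv_le_div_of_le_mul {a b c : ℝ≥0∞} (ha : a ≠ 0) (ha_top : a ≠ ∞) (h : a ≤ c * b) :
    b⁻¹ ≤ c / a := by
  rw [ENNReal.le_div_iff_mul_le (.inl ha) (.inl ha_top), mul_comm]
  exact ENNReal.div_le_of_le_mul h

theorem two_mul_sq_div_mul_div_le {a b c d e q : ℝ≥0∞} (h : a⁻¹ ≤ 2 * c / b) :
    2 * ((q / a * d) ^ 2 / e) ≤ 32 * c ^ 2 * (q ^ 2 / b ^ 2 * (d ^ 2 / (4 * e))) := by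
  have h_four : (32 : ℝ≥0∞) * 4⁻¹ = 8 := by
    rw [show (32 : ℝ≥0∞) = 8 * 4 by norm_num, mul_assoc,
      ENNReal.mul_inv_cancel four_ne_zero (by simp), mul_one]
  calc 2 * ((q / a * d) ^ 2 / e) ≤ 2 * ((q * (2 * c / b) * d) ^ 2 / e) := by
        rw [div_eq_mul_inv q]
        gcongr
    _ = 32 * 4⁻¹ * c ^ 2 * (q ^ 2 / b ^ 2 * (d ^ 2 / e)) := by
      simp only [h_four, div_eq_mul_inv, ENNReal.inv_pow]
      ring
    _ = 32 * c ^ 2 * (q ^ 2 / b ^ 2 * (d ^ 2 / (4 * e))) := by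
      simp only [div_eq_mul_inv, ENNReal.mul_inv (.inl four_ne_zero) (.inl ENNReal.ofNat_ne_top)]
      ring

variable {Ω E : Type*} [MeasurableSpace Ω] {P : Measure Ω} [NormedAddCommGroup E]

theorem lintegral_enorm_sub_le [NormedSpace ℝ E] {x : Ω → E} {U : Ω → ℝ≥0∞} (x₀ : E) {u₀ : ℝ≥0∞}
    (hu_zero : u₀ ≠ 0) (hu_top : u₀ ≠ ∞)
    (hx : AEStronglyMeasurable x P) (hU : AEMeasurable U P) :
    ∫⁻ y, ‖x y - x₀‖ₑ ∂P ≤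
      ∫⁻ y, ‖x y - (U y).toReal • u₀.toReal⁻¹ • x₀‖ₑ ∂P +
        ‖x₀‖ₑ / u₀ * ∫⁻ y, ‖(U y).toReal - u₀.toReal‖ₑ ∂P := by
  have h_pos : 0 < u₀.toReal := ENNReal.toReal_pos hu_zero hu_top
  calc ∫⁻ y, ‖x y - x₀‖ₑ ∂P
    _ ≤ ∫⁻ y, (‖x y - (U y).toReal • u₀.toReal⁻¹ • x₀‖ₑ +
          ‖x₀‖ₑ / u₀ * ‖(U y).toReal - u₀.toReal‖ₑ) ∂P := by
      refine lintegral_mono fun y => ?_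
      have h_split : x y - x₀ = (x y - (U y).toReal • u₀.toReal⁻¹ • x₀) +
          ((U y).toReal - u₀.toReal) • u₀.toReal⁻¹ • x₀ := by
        rw [sub_smul, smul_inv_smul₀ h_pos.ne']
        abel
      have h_enorm : ‖((U y).toReal - u₀.toReal) • u₀.toReal⁻¹ • x₀‖ₑ =
          ‖x₀‖ₑ / u₀ * ‖(U y).toReal - u₀.toReal‖ₑ := by
        rw [enorm_smul, enorm_smul, Real.enorm_of_nonneg (inv_nonneg.2 h_pos.le),
          ENNReal.ofReal_inv_of_pos h_pos, ENNReal.ofReal_toReal hu_top, ENNReal.div_eq_inv_mul,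
          mul_comm]
      rw [← h_enorm]
      conv_lhs => rw [h_split]
      exact enorm_add_le _ _
    _ = _ := by
      have h_meas : AEMeasurable (fun y => ‖x y - (U y).toReal • u₀.toReal⁻¹ • x₀‖ₑ) P :=
        (hx.sub (hU.ennreal_toReal.aestronglyMeasurable.smul_const _)).enorm
      rw [lintegral_add_left' h_meas, lintegral_const_mul' _ _ (by finiteness)]

theorem two_mul_sq_lintegral_enorm_sub_div_le [InnerProductSpace ℝ E] [CompleteSpace E]
    {x : Ω → E} {U V : Ω → ℝ≥0∞} {C e v₀ : ℝ≥0∞}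
    (hx : AEStronglyMeasurable x P) (hU : AEMeasurable U P) (hV : AEMeasurable V P)
    (hu_zero : ∫⁻ y, U y ∂P ≠ 0) (hu_top : ∫⁻ y, U y ∂P ≠ ∞) (hC : C ≠ ∞) (hv₀ : v₀ ≠ 0)
    (he : ∫⁻ y, U y ∂P ≤ C * e) (hv_le : v₀ ≤ (∫⁻ y, U y ∂P) * (2 * C))
    (hV₀ : ∫⁻ y, V y ∂P + (∫⁻ y, ‖(U y).toReal - (∫⁻ y, U y ∂P).toReal‖ₑ ∂P) ^ 2 / (4 * e) ≤ v₀) :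
    2 * C * (‖∫ y, x y ∂P‖ₑ ^ 2 / ∫⁻ y, U y ∂P) + 32 * C ^ 2 * (‖∫ y, x y ∂P‖ₑ ^ 2 / v₀) +
        (∫⁻ y, ‖x y - ∫ y, x y ∂P‖ₑ ∂P) ^ 2 / e ≤
      ∫⁻ y, (2 * C * (‖x y‖ₑ ^ 2 / U y) + 32 * C ^ 2 * (‖x y‖ₑ ^ 2 / V y)) ∂P := by
  set u₀ := ∫⁻ y, U y ∂P
  set x₀ := ∫ y, x y ∂P
  set d := ∫⁻ y, ‖(U y).toReal - u₀.toReal‖ₑ ∂P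
  set r := ∫⁻ y, ‖x y - (U y).toReal • u₀.toReal⁻¹ • x₀‖ₑ ∂P
  have hv₀_top : v₀ ≠ ∞ := ne_top_of_le_ne_top (by finiteness) hv_le
  have hV_top : ∫⁻ y, V y ∂P ≠ ∞ := ne_top_of_le_ne_top hv₀_top (le_self_add.trans hV₀)
  have h_var : ‖x₀‖ₑ ^ 2 / u₀ + r ^ 2 / u₀ ≤ ∫⁻ y, ‖x y‖ₑ ^ 2 / U y ∂P :=
    enorm_integral_sq_div_add_sq_div_le hx hU hu_zero hu_top
  have h_gain : ‖x₀‖ₑ ^ 2 / v₀ + ‖x₀‖ₑ ^ 2 / v₀ ^ 2 * (d ^ 2 / (4 * e)) ≤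
      ∫⁻ y, ‖x y‖ₑ ^ 2 / V y ∂P :=
    (div_add_div_sq_mul_le hv₀ hv₀_top hV₀).trans (enorm_integral_sq_div_le hx hV hV_top)
  have h_var_coeff : 2 * (r ^ 2 / e) ≤ 2 * C * (r ^ 2 / u₀) :=
    calc 2 * (r ^ 2 * e⁻¹) ≤ 2 * (r ^ 2 * (C / u₀)) := by
          gcongr
          exact inv_le_div_of_le_mul hu_zero hu_top he
      _ = 2 * C * (r ^ 2 / u₀) := by simp only [div_eq_mul_inv]; ring
  have h_gain_coeff : 2 * ((‖x₀‖ₑ / u₀ * d) ^ 2 / e) ≤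
      32 * C ^ 2 * (‖x₀‖ₑ ^ 2 / v₀ ^ 2 * (d ^ 2 / (4 * e))) :=
    two_mul_sq_div_mul_div_le (inv_le_div_of_le_mul hv₀ hv₀_top (mul_comm u₀ _ ▸ hv_le))
  calc 2 * C * (‖x₀‖ₑ ^ 2 / u₀) + 32 * C ^ 2 * (‖x₀‖ₑ ^ 2 / v₀) +
        (∫⁻ y, ‖x y - x₀‖ₑ ∂P) ^ 2 / e
    _ ≤ 2 * C * (‖x₀‖ₑ ^ 2 / u₀) + 32 * C ^ 2 * (‖x₀‖ₑ ^ 2 / v₀) +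
          (2 * (r ^ 2 / e) + 2 * ((‖x₀‖ₑ / u₀ * d) ^ 2 / e)) := by
      rw [← mul_div_assoc 2, ← mul_div_assoc 2, ENNReal.div_add_div_same]
      gcongr
      exact (pow_le_pow_left' (lintegral_enorm_sub_le x₀ hu_zero hu_top hx hU) 2).trans
        (add_sq_le_two_mul_add_sq _ _)
    _ ≤ 2 * C * (‖x₀‖ₑ ^ 2 / u₀ + r ^ 2 / u₀) + 32 * C ^ 2 *
          (‖x₀‖ₑ ^ 2 / v₀ + ‖x₀‖ₑ ^ 2 / v₀ ^ 2 * (d ^ 2 / (4 * e))) := by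
      rw [mul_add, mul_add, add_add_add_comm]
      gcongr
    _ ≤ 2 * C * ∫⁻ y, ‖x y‖ₑ ^ 2 / U y ∂P + 32 * C ^ 2 * ∫⁻ y, ‖x y‖ₑ ^ 2 / V y ∂P := by gcongr
    _ = _ := by
      rw [lintegral_add_left' (by fun_prop), lintegral_const_mul' _ _ (by finiteness),
        lintegral_const_mul' _ _ (by finiteness)]

end Bellman

section BellmanKernel

open ProbabilityTheory

variable {X Y E : Type*} [MeasurableSpace X] [MeasurableSpace Y] [NormedAddCommGroup E]
  [NormedSpace ℝ E] {α : ℝ → ℝ≥0} {u : X → ℝ≥0} {g : X → E}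

/-- The Bellman function of the problem, evaluated at the averages over the probability measure
`ν`. Both summands are jointly convex: the first one in `(∫ g, ∫ u)`, the second one in
`(∫ g, ∫ u, lorentzNorm u)` because `bumpPerspective` is concave. In `32 = 2 * 2 ^ 2 * 4` the first
factor comes from `(a + b) ^ 2 ≤ 2 * a ^ 2 + 2 * b ^ 2`, the second one from `bumpProfile_le`, and
the third one from the gain in `lintegral_lorentzNorm_kernel_add_sq_div_le`. -/
noncomputable def bellmanFunction (α : ℝ → ℝ≥0) (u : X → ℝ≥0) (g : X → E) (ν : Measure X) :
    ℝ≥0∞ :=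
  2 * bumpConst α * (‖∫ x, g x ∂ν‖ₑ ^ 2 / ∫⁻ x, (u x : ℝ≥0∞) ∂ν) +
    32 * bumpConst α ^ 2 *
      (‖∫ x, g x ∂ν‖ₑ ^ 2 / bumpPerspective α (∫⁻ x, (u x : ℝ≥0∞) ∂ν) (lorentzNorm ν u))

theorem enorm_integral_sq_div_lintegral_le_bellmanFunction (ν : Measure X) :
    2 * bumpConst α * (‖∫ x, g x ∂ν‖ₑ ^ 2 / ∫⁻ x, (u x : ℝ≥0∞) ∂ν) ≤ bellmanFunction α u g ν :=
  le_self_add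

theorem bellmanFunction_le (hC : bumpConst α ≠ ∞) (ν : Measure X) :
    bellmanFunction α u g ν ≤
      34 * bumpConst α * (‖∫ x, g x ∂ν‖ₑ ^ 2 / ∫⁻ x, (u x : ℝ≥0∞) ∂ν) := by
  set C := bumpConst α
  set q := ‖∫ x, g x ∂ν‖ₑ ^ 2
  set v := ∫⁻ x, (u x : ℝ≥0∞) ∂ν
  calc 2 * C * (q / v) + 32 * C ^ 2 * (q / bumpPerspective α v (lorentzNorm ν u))
    _ ≤ 2 * C * (q / v) + 32 * C ^ 2 * (q / (v * C)) := by
      gcongr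
      exact mul_bumpConst_le_bumpPerspective _ _
    _ = 2 * C * (q / v) + 32 * C * (C * C⁻¹) * (q / v) := by
      simp only [div_eq_mul_inv, ENNReal.mul_inv (.inr hC) (.inr bumpConst_ne_zero)]
      ring
    _ = 34 * C * (q / v) := by
      rw [ENNReal.mul_inv_cancel bumpConst_ne_zero hC]
      ring

theorem aestronglyMeasurable_integral_kernel {κ : Kernel Y X} {P : Measure Y} [SFinite P]
    [IsSFiniteKernel κ] (hg : AEStronglyMeasurable g (κ ∘ₘ P)) :
    AEStronglyMeasurable (fun y => ∫ x, g x ∂κ y) P := by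
  rw [Measure.comp_eq_comp_const_apply] at hg
  simpa using hg.integral_kernel_comp

theorem integral_comp_eq_integral_integral {κ : Kernel Y X} {P : Measure Y} [SFinite P]
    [IsSFiniteKernel κ] (hg : Integrable g (κ ∘ₘ P)) :
    ∫ x, g x ∂(κ ∘ₘ P) = ∫ y, ∫ x, g x ∂κ y ∂P := by
  rw [Measure.comp_eq_comp_const_apply] at hg ⊢
  simpa using Kernel.integral_comp hg

theorem ae_integral_kernel_eq_zero {κ : Kernel Y X} {P : Measure Y}
    (hx : AEStronglyMeasurable (fun y => ∫ x, g x ∂κ y) P)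
    (hu : Measurable u) (hC : bumpConst α ≠ ∞)
    (hu_zero : ∫⁻ y, ∫⁻ x, (u x : ℝ≥0∞) ∂κ y ∂P = 0)
    (h_top : ∫⁻ y, bellmanFunction α u g (κ y) ∂P ≠ ∞) :
    ∀ᵐ y ∂P, ∫ x, g x ∂κ y = 0 := by
  have hU : Measurable fun y => ∫⁻ x, (u x : ℝ≥0∞) ∂κ y :=
    hu.coe_nnreal_ennreal.lintegral_kernel
  have hC2 : 2 * bumpConst α ≠ 0 := mul_ne_zero two_ne_zero bumpConst_ne_zero
  have h_energy : ∫⁻ y, ‖∫ x, g x ∂κ y‖ₑ ^ 2 / ∫⁻ x, (u x : ℝ≥0∞) ∂κ y ∂P ≠ ∞ := by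
    have h_le := lintegral_mono (μ := P) fun y =>
      enorm_integral_sq_div_lintegral_le_bellmanFunction (α := α) (u := u) (g := g) (κ y)
    rw [lintegral_const_mul' _ _ (by finiteness)] at h_le
    exact fun h => h_top (top_le_iff.1 (by rwa [h, ENNReal.mul_top hC2] at h_le))
  filter_upwards [ae_eq_zero_of_lintegral_sq_div_ne_top hx hU.aemeasurable h_energy,
    (lintegral_eq_zero_iff hU).1 hu_zero] with y hxy hy using hxy hy

theorem bellmanFunction_comp_add_le {E : Type*} [NormedAddCommGroup E] [InnerProductSpace ℝ E]
    [CompleteSpace E] {g : X → E} {κ : Kernel Y X} [IsMarkovKernel κ] {P : Measure Y}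
    [IsProbabilityMeasure P] (hα : MonotoneOn α (Ici 1)) (hC : bumpConst α ≠ ∞)
    (hu : Measurable u) (hu_top : ∫⁻ x, (u x : ℝ≥0∞) ∂(κ ∘ₘ P) ≠ ∞)
    (hg : Integrable g (κ ∘ₘ P)) :
    bellmanFunction α u g (κ ∘ₘ P) +
        (∫⁻ y, ‖∫ x, g x ∂κ y - ∫ x, g x ∂(κ ∘ₘ P)‖ₑ ∂P) ^ 2 / entropyBump α (κ ∘ₘ P) u ≤
      ∫⁻ y, bellmanFunction α u g (κ y) ∂P := by
  have hx : AEStronglyMeasurable (fun y => ∫ x, g x ∂κ y) P :=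
    aestronglyMeasurable_integral_kernel hg.aestronglyMeasurable
  have h_mean : ∫ y, ∫ x, g x ∂κ y ∂P = ∫ x, g x ∂(κ ∘ₘ P) :=
    (integral_comp_eq_integral_integral hg).symm
  have h_bind : ∫⁻ x, (u x : ℝ≥0∞) ∂(κ ∘ₘ P) = ∫⁻ y, ∫⁻ x, (u x : ℝ≥0∞) ∂κ y ∂P :=
    Measure.lintegral_bind κ.measurable.aemeasurable hu.coe_nnreal_ennreal.aemeasurable
  have hU : Measurable fun y => ∫⁻ x, (u x : ℝ≥0∞) ∂κ y :=
    hu.coe_nnreal_ennreal.lintegral_kernel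
  rcases eq_or_ne (∫⁻ x, (u x : ℝ≥0∞) ∂(κ ∘ₘ P)) 0 with hu_zero | hu_zero
  · rcases eq_or_ne (∫⁻ y, bellmanFunction α u g (κ y) ∂P) ∞ with h_top | h_top
    · exact h_top ▸ le_top
    have h_vanish : ∀ᵐ y ∂P, ∫ x, g x ∂κ y = 0 :=
      ae_integral_kernel_eq_zero hx hu hC (h_bind ▸ hu_zero) h_top
    have h_mean_zero : ∫ x, g x ∂(κ ∘ₘ P) = 0 := h_mean ▸ integral_eq_zero_of_ae h_vanish
    have h_diff : ∫⁻ y, ‖∫ x, g x ∂κ y‖ₑ ∂P = 0 := by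
      simp [lintegral_congr_ae (h_vanish.mono fun _ hy => congrArg enorm hy)]
    simp [bellmanFunction, h_mean_zero, h_diff]
  · have h_gain := lintegral_bumpPerspective_kernel_add_le hα hC hu hu_zero hu_top
    have hv₀ : bumpPerspective α (∫⁻ x, (u x : ℝ≥0∞) ∂(κ ∘ₘ P)) (lorentzNorm (κ ∘ₘ P) u) ≠ 0 :=
      ((ENNReal.mul_pos hu_zero bumpConst_ne_zero).trans_le
        (mul_bumpConst_le_bumpPerspective _ _)).ne'
    have he := lintegral_le_bumpConst_mul_entropyBump hα hC hu (ν := κ ∘ₘ P)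
    have hv_le := bumpPerspective_le (α := α) (∫⁻ x, (u x : ℝ≥0∞) ∂(κ ∘ₘ P))
      (lorentzNorm (κ ∘ₘ P) u)
    simp only [bellmanFunction]
    rw [h_bind] at hu_zero hu_top h_gain hv₀ he hv_le ⊢
    rw [← h_mean]
    exact two_mul_sq_lintegral_enorm_sub_div_le hx hU.aemeasurable
      (aemeasurable_bumpPerspective hU.aemeasurable
        (measurable_lorentzNorm_kernel hu).aemeasurable) hu_zero hu_top hC hv₀ he hv_le h_gain

end BellmanKernel

namespace AtomicFiltration

section Atoms

open ProbabilityTheory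

variable {X : Type*} [MeasurableSpace X] {μ : Measure X} {D : AtomicFiltration μ}

theorem measurableSet_of_mem_atoms {n : ℤ} {I : Set X} (hI : I ∈ D.atoms n) : MeasurableSet I :=
  D.filtration.le n _ (D.measurableSet_atoms n I hI)

theorem nonempty_of_mem_atoms {n : ℤ} {I : Set X} (hI : I ∈ D.atoms n) : I.Nonempty :=
  nonempty_of_measure_ne_zero (D.measure_atoms_pos n I hI).ne'

theorem measure_smul_cond {n : ℤ} {I : Set X} (hI : I ∈ D.atoms n) :
    μ I • μ[|I] = μ.restrict I := by
  rw [ProbabilityTheory.cond, smul_smul, ENNReal.mul_inv_cancel (D.measure_atoms_pos n I hI).ne'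
    (D.measure_atoms_lt_top n I hI).ne, one_smul]

theorem exists_mem_atoms_mem (D : AtomicFiltration μ) (n : ℤ) (y : X) :
    ∃ I ∈ D.atoms n, y ∈ I := by
  obtain ⟨T, hT, hT_univ⟩ := D.exists_eq_sUnion n univ .univ
  obtain ⟨I, hI, hy⟩ := mem_sUnion.1 (hT_univ ▸ mem_univ y)
  exact ⟨I, hT hI, hy⟩

/-- The atom of generation `n` that contains the point `y`. -/
noncomputable def cell (D : AtomicFiltration μ) (n : ℤ) (y : X) : Set X :=
  (D.exists_mem_atoms_mem n y).choose

theorem cell_mem_atoms (D : AtomicFiltration μ) (n : ℤ) (y : X) : D.cell n y ∈ D.atoms n :=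
  (D.exists_mem_atoms_mem n y).choose_spec.1

theorem mem_cell (D : AtomicFiltration μ) (n : ℤ) (y : X) : y ∈ D.cell n y :=
  (D.exists_mem_atoms_mem n y).choose_spec.2

theorem cell_eq_of_mem {n : ℤ} {I : Set X} (hI : I ∈ D.atoms n) {y : X} (hy : y ∈ I) :
    D.cell n y = I :=
  (D.disjoint_atoms n).elim_set (D.cell_mem_atoms n y) hI y (D.mem_cell n y) hy

theorem sUnion_atoms (D : AtomicFiltration μ) (n : ℤ) : ⋃₀ D.atoms n = univ :=
  eq_univ_of_forall fun y => ⟨D.cell n y, D.cell_mem_atoms n y, D.mem_cell n y⟩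

theorem cell_subset_of_mem {n m : ℤ} (hnm : n ≤ m) {I : Set X} (hI : I ∈ D.atoms n) {y : X}
    (hy : y ∈ I) : D.cell m y ⊆ I := by
  obtain ⟨T, hT, rfl⟩ := D.exists_eq_sUnion m I
    (D.filtration.mono hnm _ (D.measurableSet_atoms n I hI))
  obtain ⟨J, hJ, hyJ⟩ := mem_sUnion.1 hy
  rw [cell_eq_of_mem (hT hJ) hyJ]
  exact subset_sUnion_of_mem hJ

theorem mem_atoms_of_mem_of_mem {k l m : ℤ} (hkl : k ≤ l) (hlm : l ≤ m) {I : Set X}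
    (hk : I ∈ D.atoms k) (hm : I ∈ D.atoms m) : I ∈ D.atoms l := by
  obtain ⟨y, hy⟩ := nonempty_of_mem_atoms hk
  have h_sub : D.cell l y ⊆ I := cell_subset_of_mem hkl hk hy
  have h_sup : I ⊆ D.cell l y :=
    cell_eq_of_mem hm hy ▸ cell_subset_of_mem hlm (D.cell_mem_atoms l y) (D.mem_cell l y)
  exact h_sup.antisymm h_sub ▸ D.cell_mem_atoms l y

theorem children_eq_of_isGreatest {n : ℤ} {I : Set X}
    (h : IsGreatest {k | I ∈ D.atoms k} n) :
    D.children I = {J | J ∈ D.atoms (n + 1) ∧ J ⊆ I} := by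
  ext J
  constructor
  · rintro (⟨m, hm, hJ⟩ | ⟨⟨m, hm⟩, -⟩)
    · rwa [hm.unique h] at hJ
    · have h_le : max m (n + 1) ≤ n := h.2 (hm _ (le_max_left _ _))
      exact absurd ((le_max_right _ _).trans h_le) (by simp)
  · exact fun hJ => Or.inl ⟨n, h, hJ⟩

theorem children_eq_singleton {I : Set X} (hI : I ∈ D.allAtoms)
    (h : ¬∃ n, IsGreatest {k | I ∈ D.atoms k} n) : D.children I = {I} := by
  obtain ⟨n, hn⟩ := mem_iUnion.1 hI
  have h_unbdd (m : ℤ) : ∃ k, m < k ∧ I ∈ D.atoms k := by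
    by_contra! hm
    obtain ⟨b, hb, hb_max⟩ := Int.exists_greatest_of_bdd (P := fun k => I ∈ D.atoms k)
      ⟨m, fun z hz => not_lt.1 fun hlt => hm z hlt hz⟩ ⟨n, hn⟩
    exact h ⟨b, hb, hb_max⟩
  have h_late (k : ℤ) (hk : n ≤ k) : I ∈ D.atoms k := by
    obtain ⟨l, hl, hIl⟩ := h_unbdd k
    exact mem_atoms_of_mem_of_mem hk hl.le hn hIl
  ext J
  simp only [children, not_exists.1 h, false_and, exists_false, false_or, mem_ofPred_eq,
    mem_singleton_iff, and_iff_right_iff_imp]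
  exact fun _ => ⟨n, h_late⟩

theorem measurable_comp_cell {γ : Type*} [MeasurableSpace γ] (n : ℤ) (F : Set X → γ) :
    Measurable fun y => F (D.cell n y) := by
  intro s _
  have h_preimage : (fun y => F (D.cell n y)) ⁻¹' s = ⋃₀ {J ∈ D.atoms n | F J ∈ s} := by
    ext y
    constructor
    · exact fun hy => ⟨_, ⟨D.cell_mem_atoms n y, hy⟩, D.mem_cell n y⟩
    · rintro ⟨J, ⟨hJ, hJs⟩, hy⟩
      rwa [mem_preimage, cell_eq_of_mem hJ hy]
  rw [h_preimage]
  exact .sUnion ((D.countable_atoms n).mono (sep_subset _ _))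
    fun J hJ => measurableSet_of_mem_atoms hJ.1

theorem restrict_sUnion_eq_sum {n : ℤ} {T : Set (Set X)} (hT : T ⊆ D.atoms n) :
    μ.restrict (⋃₀ T) = Measure.sum fun J : T => μ.restrict (J : Set X) := by
  have : Countable T := ((D.countable_atoms n).mono hT).to_subtype
  rw [sUnion_eq_iUnion]
  exact Measure.restrict_iUnion
    (fun J K hJK => D.disjoint_atoms n (hT J.2) (hT K.2) (Subtype.coe_ne_coe.2 hJK))
    fun J => measurableSet_of_mem_atoms (hT J.2)

theorem lintegral_comp_cell (n : ℤ) (F : Set X → ℝ≥0∞) :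
    ∫⁻ y, F (D.cell n y) ∂μ = ∑' J : D.atoms n, F J * μ (J : Set X) := by
  rw [← setLIntegral_univ, ← D.sUnion_atoms n, restrict_sUnion_eq_sum subset_rfl,
    lintegral_sum_measure]
  refine tsum_congr fun J => ?_
  rw [setLIntegral_congr_fun (measurableSet_of_mem_atoms J.2)
    fun y hy => congrArg F (cell_eq_of_mem J.2 hy), setLIntegral_const]

/-- The kernel that averages over the atoms of generation `n`, so that integration against it is
the conditional expectation on the `n`-th σ-algebra: the point `y` is sent to `μ` conditioned on
the atom of generation `n` that contains `y`. -/
noncomputable def cellKernel (D : AtomicFiltration μ) (n : ℤ) : Kernel X X where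
  toFun y := μ[|D.cell n y]
  measurable' := measurable_comp_cell n fun I => μ[|I]

theorem cellKernel_apply (n : ℤ) (y : X) : D.cellKernel n y = μ[|D.cell n y] := rfl

instance isMarkovKernel_cellKernel (D : AtomicFiltration μ) (n : ℤ) :
    IsMarkovKernel (D.cellKernel n) where
  isProbabilityMeasure y :=
    have hI := D.cell_mem_atoms n y
    cond_isProbabilityMeasure_of_finite (D.measure_atoms_pos n _ hI).ne'
      (D.measure_atoms_lt_top n _ hI).ne

theorem cellKernel_comp_restrict_atom {n : ℤ} {I : Set X} (hI : I ∈ D.atoms n) :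
    D.cellKernel n ∘ₘ μ.restrict I = μ.restrict I := by
  have h_const : D.cellKernel n =ᵐ[μ.restrict I] fun _ => μ[|I] := by
    filter_upwards [ae_restrict_mem (measurableSet_of_mem_atoms hI)] with y hy
    rw [cellKernel_apply, cell_eq_of_mem hI hy]
  rw [Measure.bind_congr_right h_const, Measure.bind_const, Measure.restrict_apply_univ,
    measure_smul_cond hI]

theorem cellKernel_comp_restrict {n : ℤ} {A : Set X} (hA : MeasurableSet[D.filtration n] A) :
    D.cellKernel n ∘ₘ μ.restrict A = μ.restrict A := by
  obtain ⟨T, hT, rfl⟩ := D.exists_eq_sUnion n A hA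
  rw [restrict_sUnion_eq_sum hT, Measure.bind_sum _ _ (D.cellKernel n).measurable.aemeasurable]
  exact congrArg Measure.sum (funext fun J => cellKernel_comp_restrict_atom (hT J.2))

theorem cellKernel_comp (D : AtomicFiltration μ) (n : ℤ) : D.cellKernel n ∘ₘ μ = μ := by
  simpa only [Measure.restrict_univ] using cellKernel_comp_restrict (D := D) (n := n) .univ

theorem cellKernel_comp_cellKernel_apply {n m : ℤ} (hnm : n ≤ m) (y : X) :
    D.cellKernel m ∘ₘ D.cellKernel n y = D.cellKernel n y := by
  rw [cellKernel_apply, ProbabilityTheory.cond, Measure.comp_smul, cellKernel_comp_restrict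
    (D.filtration.mono hnm _ (D.measurableSet_atoms n _ (D.cell_mem_atoms n y)))]

end Atoms

section MartingaleDiff

variable {X : Type*} [MeasurableSpace X] {μ : Measure X} {D : AtomicFiltration μ} {𝕜 : Type*}
  [RCLike 𝕜]

theorem martingaleDiff_eq_of_isGreatest {n : ℤ} {I : Set X}
    (hI : IsGreatest {k | I ∈ D.atoms k} n) (g : X → 𝕜) {y : X} (hy : y ∈ I) :
    D.martingaleDiff I g y = ∫ x, g x ∂D.cellKernel (n + 1) y - ∫ x, g x ∂D.cellKernel n y := by
  have h_child : D.cell (n + 1) y ∈ D.children I := by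
    rw [children_eq_of_isGreatest hI]
    exact ⟨D.cell_mem_atoms _ y, cell_subset_of_mem (Int.le_add_one le_rfl) hI.1 hy⟩
  rw [martingaleDiff, tsum_eq_single ⟨_, h_child⟩]
  · simp [D.mem_cell, hy, setAverage_eq', ProbabilityTheory.cond, cellKernel_apply,
      cell_eq_of_mem hI.1 hy]
  · rintro ⟨J, hJ⟩ hne
    rw [children_eq_of_isGreatest hI] at hJ
    refine indicator_of_notMem (fun hyJ => hne ?_) _
    exact Subtype.ext (cell_eq_of_mem hJ.1 hyJ).symm

theorem martingaleDiff_eq_zero {I : Set X} (hI : I ∈ D.allAtoms)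
    (h : ¬∃ n, IsGreatest {k | I ∈ D.atoms k} n) (g : X → 𝕜) : D.martingaleDiff I g = 0 := by
  funext y
  rw [martingaleDiff, children_eq_singleton hI h,
    tsum_singleton I fun J => J.indicator (fun _ => ⨍ z in J, g z ∂μ) y, sub_self, Pi.zero_apply]

end MartingaleDiff

end AtomicFiltration

section Telescoping

theorem add_sum_range_le_of_add_le {M : Type*} [AddCommMonoid M] [Preorder M] [AddRightMono M]
    {S T : ℤ → M} (hST : ∀ n, S n + T n ≤ S (n + 1)) (a : ℤ) (k : ℕ) :
    S a + ∑ i ∈ Finset.range k, T (a + i) ≤ S (a + k) := by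
  induction k with
  | zero => simp
  | succ k ih =>
    calc S a + ∑ i ∈ Finset.range (k + 1), T (a + i)
      _ = S a + ∑ i ∈ Finset.range k, T (a + i) + T (a + k) := by
        rw [Finset.sum_range_succ, add_assoc]
      _ ≤ S (a + k) + T (a + k) := by gcongr
      _ ≤ S (a + k + 1) := hST _
      _ = S (a + (k + 1 : ℕ)) := by push_cast; rw [add_assoc]

theorem exists_subset_image_add_range (s : Finset ℤ) :
    ∃ (a : ℤ) (k : ℕ), s ⊆ (Finset.range k).image fun i : ℕ => a + i := by
  obtain ⟨a, ha⟩ := s.bddBelow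
  obtain ⟨b, hb⟩ := s.bddAbove
  refine ⟨a, (b - a + 1).toNat, fun n hn => Finset.mem_image.2 ⟨(n - a).toNat, ?_, ?_⟩⟩
  all_goals
    have hna : a ≤ n := ha hn
    have hnb : n ≤ b := hb hn
    grind

theorem tsum_int_le_of_add_le {S T : ℤ → ℝ≥0∞} {M : ℝ≥0∞} (hST : ∀ n, S n + T n ≤ S (n + 1))
    (hS : ∀ n, S n ≤ M) : ∑' n, T n ≤ M := by
  rw [ENNReal.tsum_eq_iSup_sum]
  refine iSup_le fun s => ?_
  obtain ⟨a, k, hs⟩ := exists_subset_image_add_range s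
  calc ∑ n ∈ s, T n
    _ ≤ ∑ n ∈ (Finset.range k).image fun i : ℕ => a + i, T n := Finset.sum_le_sum_of_subset hs
    _ = ∑ i ∈ Finset.range k, T (a + i) := Finset.sum_image fun i _ j _ h => by simpa using h
    _ ≤ S (a + k) := le_add_self.trans (add_sum_range_le_of_add_le hST a k)
    _ ≤ M := hS _

end Telescoping

section WeightedEnergy

variable {X E : Type*} [MeasurableSpace X] {μ : Measure X} [NormedAddCommGroup E]
  [NormedSpace ℝ E] {u : X → ℝ≥0}

theorem mul_enorm_sq_eq_enorm_smul_sq_div (a : ℝ≥0) (x : E) :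
    (a : ℝ≥0∞) * ‖x‖ₑ ^ 2 = ‖(a : ℝ) • x‖ₑ ^ 2 / a := by
  rcases eq_or_ne a 0 with rfl | ha
  · simp
  · have ha' : (a : ℝ≥0∞) ≠ 0 := ENNReal.coe_ne_zero.2 ha
    rw [enorm_smul, Real.enorm_of_nonneg a.coe_nonneg, ENNReal.ofReal_coe_nnreal,
      show (a * ‖x‖ₑ) ^ 2 = a * ‖x‖ₑ ^ 2 * a by ring,
      ENNReal.mul_div_cancel_right ha' ENNReal.coe_ne_top]

theorem eLpNorm_two_withDensity_sq (hu : Measurable u) (f : X → E) :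
    eLpNorm f 2 (μ.withDensity fun x => (u x : ℝ≥0∞)) ^ 2 =
      ∫⁻ x, ‖(u x : ℝ) • f x‖ₑ ^ 2 / (u x : ℝ≥0∞) ∂μ := by
  have h_sq : eLpNorm f 2 (μ.withDensity fun x => (u x : ℝ≥0∞)) ^ 2 =
      ∫⁻ x, ‖f x‖ₑ ^ 2 ∂μ.withDensity fun x => (u x : ℝ≥0∞) := by
    simpa using eLpNorm_nnreal_pow_eq_lintegral (f := f) (p := 2) two_ne_zero
  rw [h_sq, lintegral_withDensity_eq_lintegral_mul_non_measurable _ hu.coe_nnreal_ennreal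
    (.of_forall fun x => ENNReal.coe_lt_top)]
  exact lintegral_congr fun x => mul_enorm_sq_eq_enorm_smul_sq_div (u x) (f x)

end WeightedEnergy

namespace AtomicFiltration

open ProbabilityTheory

section Generation

variable {X E : Type*} [MeasurableSpace X] {μ : Measure X} {D : AtomicFiltration μ}
  [NormedAddCommGroup E] {α : ℝ → ℝ≥0} {u : X → ℝ≥0} {g : X → E}

theorem lintegral_cellKernel_ne_top {h : X → ℝ≥0∞} {n : ℤ} {y : X}
    (hh : ∫⁻ x in D.cell n y, h x ∂μ ≠ ∞) : ∫⁻ x, h x ∂D.cellKernel n y ≠ ∞ := by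
  rw [cellKernel_apply, ProbabilityTheory.cond, lintegral_smul_measure]
  exact ENNReal.mul_ne_top
    (ENNReal.inv_ne_top.2 (D.measure_atoms_pos n _ (D.cell_mem_atoms n y)).ne') hh

theorem lintegral_lintegral_cellKernel {h : X → ℝ≥0∞} (hh : AEMeasurable h μ) (n : ℤ) :
    ∫⁻ y, ∫⁻ x, h x ∂D.cellKernel n y ∂μ = ∫⁻ x, h x ∂μ := by
  rw [← Measure.lintegral_bind (D.cellKernel n).measurable.aemeasurable (by rwa [cellKernel_comp]),
    cellKernel_comp]

/-- The contribution of an atom `I` of generation `n` to the sum to be estimated, the martingale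
difference on `I` being taken between the generations `n` and `n + 1` even if `I` is still an atom
of generation `n + 1`. -/
noncomputable def generationTerm [NormedSpace ℝ E] (D : AtomicFiltration μ) (α : ℝ → ℝ≥0)
    (u : X → ℝ≥0) (g : X → E) (n : ℤ) (I : Set X) : ℝ≥0∞ :=
  (∫⁻ y, ‖∫ x, g x ∂D.cellKernel (n + 1) y - ∫ x, g x ∂μ[|I]‖ₑ ∂μ[|I]) ^ 2 /
    entropyBump α μ[|I] u

variable [InnerProductSpace ℝ E] [CompleteSpace E]

theorem lintegral_bellmanFunction_cellKernel_le (hC : bumpConst α ≠ ∞) (hu : Measurable u)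
    (hu_int : ∀ I ∈ D.allAtoms, ∫⁻ x in I, (u x : ℝ≥0∞) ∂μ ≠ ∞)
    (hg : AEStronglyMeasurable g μ) (n : ℤ) :
    ∫⁻ y, bellmanFunction α u g (D.cellKernel n y) ∂μ ≤
      34 * bumpConst α * ∫⁻ x, ‖g x‖ₑ ^ 2 / (u x : ℝ≥0∞) ∂μ := by
  have h_jensen (y : X) : ‖∫ x, g x ∂D.cellKernel n y‖ₑ ^ 2 / ∫⁻ x, (u x : ℝ≥0∞) ∂D.cellKernel n y
      ≤ ∫⁻ x, ‖g x‖ₑ ^ 2 / (u x : ℝ≥0∞) ∂D.cellKernel n y :=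
    enorm_integral_sq_div_le (hg.mono_ac cond_absolutelyContinuous)
      hu.coe_nnreal_ennreal.aemeasurable
      (lintegral_cellKernel_ne_top (hu_int _ (mem_iUnion.2 ⟨n, D.cell_mem_atoms n y⟩)))
  have h_meas : AEMeasurable (fun x => ‖g x‖ₑ ^ 2 / (u x : ℝ≥0∞)) μ :=
    (hg.enorm.pow_const 2).div hu.coe_nnreal_ennreal.aemeasurable
  calc ∫⁻ y, bellmanFunction α u g (D.cellKernel n y) ∂μ
    _ ≤ ∫⁻ y, 34 * bumpConst α * ∫⁻ x, ‖g x‖ₑ ^ 2 / (u x : ℝ≥0∞) ∂D.cellKernel n y ∂μ :=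
      lintegral_mono fun y => (bellmanFunction_le hC _).trans (by gcongr; exact h_jensen y)
    _ = 34 * bumpConst α * ∫⁻ y, ∫⁻ x, ‖g x‖ₑ ^ 2 / (u x : ℝ≥0∞) ∂D.cellKernel n y ∂μ :=
      lintegral_const_mul' _ _ (by finiteness)
    _ = 34 * bumpConst α * ∫⁻ x, ‖g x‖ₑ ^ 2 / (u x : ℝ≥0∞) ∂μ := by
      rw [lintegral_lintegral_cellKernel h_meas]

theorem bellmanFunction_cellKernel_add_le (hα : MonotoneOn α (Ici 1)) (hC : bumpConst α ≠ ∞)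
    (hu : Measurable u) {n : ℤ} {y : X} (hu_top : ∫⁻ x, (u x : ℝ≥0∞) ∂D.cellKernel n y ≠ ∞)
    (hg : Integrable g (D.cellKernel n y)) :
    bellmanFunction α u g (D.cellKernel n y) + D.generationTerm α u g n (D.cell n y) ≤
      ∫⁻ z, bellmanFunction α u g (D.cellKernel (n + 1) z) ∂D.cellKernel n y := by
  have h_comp := D.cellKernel_comp_cellKernel_apply (Int.le_add_one (le_refl n)) y
  have h_step := bellmanFunction_comp_add_le (κ := D.cellKernel (n + 1)) (P := D.cellKernel n y)
    (g := g) hα hC hu (by rwa [h_comp]) (by rwa [h_comp])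
  rwa [h_comp] at h_step

theorem tsum_lintegral_generationTerm_le (hα : MonotoneOn α (Ici 1)) (hC : bumpConst α ≠ ∞)
    (hu : Measurable u) (hu_int : ∀ I ∈ D.allAtoms, ∫⁻ x in I, (u x : ℝ≥0∞) ∂μ ≠ ∞)
    (hg : AEStronglyMeasurable g μ) :
    ∑' n, ∫⁻ y, D.generationTerm α u g n (D.cell n y) ∂μ ≤
      34 * bumpConst α * ∫⁻ x, ‖g x‖ₑ ^ 2 / (u x : ℝ≥0∞) ∂μ := by
  rcases eq_or_ne (∫⁻ x, ‖g x‖ₑ ^ 2 / (u x : ℝ≥0∞) ∂μ) ∞ with h_energy | h_energy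
  · rw [h_energy, ENNReal.mul_top (mul_ne_zero (by norm_num) bumpConst_ne_zero)]
    exact le_top
  refine tsum_int_le_of_add_le (fun n => ?_)
    (lintegral_bellmanFunction_cellKernel_le hC hu hu_int hg)
  have hB (m : ℤ) : Measurable fun y => bellmanFunction α u g (D.cellKernel m y) :=
    measurable_comp_cell m fun I => bellmanFunction α u g μ[|I]
  rw [← lintegral_add_left (hB n),
    ← lintegral_lintegral_cellKernel (D := D) (hB (n + 1)).aemeasurable n]
  refine lintegral_mono fun y => ?_
  have hu_top : ∫⁻ x, (u x : ℝ≥0∞) ∂D.cellKernel n y ≠ ∞ :=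
    lintegral_cellKernel_ne_top (hu_int _ (mem_iUnion.2 ⟨n, D.cell_mem_atoms n y⟩))
  have hg_int : Integrable g (D.cellKernel n y) :=
    integrable_of_lintegral_sq_div_ne_top (hg.mono_ac cond_absolutelyContinuous)
      hu.coe_nnreal_ennreal.aemeasurable hu_top (lintegral_cellKernel_ne_top
        ((setLIntegral_le_lintegral _ _).trans_lt h_energy.lt_top).ne)
  exact bellmanFunction_cellKernel_add_le hα hC hu hu_top hg_int

end Generation

section AllAtoms

variable {X : Type*} [MeasurableSpace X] {μ : Measure X} {D : AtomicFiltration μ}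

theorem tsum_allAtoms_le {a : Set X → ℝ≥0∞} {b : ℤ → Set X → ℝ≥0∞}
    (h : ∀ I ∈ D.allAtoms, a I ≠ 0 → ∃ n, I ∈ D.atoms n ∧ a I ≤ b n I) :
    ∑' I : D.allAtoms, a I ≤ ∑' n, ∑' I : D.atoms n, b n I := by
  simp_rw [tsum_subtype D.allAtoms a, fun n => tsum_subtype (D.atoms n) (b n)]
  rw [ENNReal.tsum_comm]
  refine ENNReal.tsum_le_tsum fun I => ?_
  rcases eq_or_ne (D.allAtoms.indicator a I) 0 with h_zero | h_ne
  · exact h_zero ▸ zero_le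
  obtain ⟨hI, haI⟩ := indicator_apply_ne_zero.1 h_ne
  obtain ⟨n, hIn, hab⟩ := h I hI haI
  calc D.allAtoms.indicator a I
    _ = a I := indicator_of_mem hI a
    _ ≤ b n I := hab
    _ = (D.atoms n).indicator (b n) I := (indicator_of_mem hIn _).symm
    _ ≤ ∑' n, (D.atoms n).indicator (b n) I := ENNReal.le_tsum n

variable {𝕜 : Type*} [RCLike 𝕜]

theorem eLpNorm_martingaleDiff_sq_div_entropyBump (α : ℝ → ℝ≥0) (u : X → ℝ≥0) (g : X → 𝕜)
    {n : ℤ} {I : Set X} (hI : IsGreatest {k | I ∈ D.atoms k} n) :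
    eLpNorm (D.martingaleDiff I g) 1 μ[|I] ^ 2 / entropyBump α μ[|I] u =
      D.generationTerm α u g n I := by
  rw [generationTerm, eLpNorm_one_eq_lintegral_enorm]
  congr 2
  refine lintegral_congr_ae ?_
  filter_upwards [ae_cond_mem (measurableSet_of_mem_atoms hI.1)] with y hy
  rw [martingaleDiff_eq_of_isGreatest hI g hy, cellKernel_apply n, cell_eq_of_mem hI.1 hy]

theorem tsum_eLpNorm_martingaleDiff_le (α : ℝ → ℝ≥0) (u : X → ℝ≥0) (g : X → 𝕜) :
    ∑' I : D.allAtoms, eLpNorm (D.martingaleDiff (I : Set X) g) 1 μ[|(I : Set X)] ^ 2 /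
        entropyBump α μ[|(I : Set X)] u * μ (I : Set X) ≤
      ∑' n, ∫⁻ y, D.generationTerm α u g n (D.cell n y) ∂μ := by
  simp_rw [lintegral_comp_cell]
  refine tsum_allAtoms_le (a := fun I => eLpNorm (D.martingaleDiff I g) 1 μ[|I] ^ 2 /
    entropyBump α μ[|I] u * μ I) (b := fun n I => D.generationTerm α u g n I * μ I)
    fun I hI h_ne => ?_
  obtain ⟨n, hn⟩ : ∃ n, IsGreatest {k | I ∈ D.atoms k} n := by
    by_contra h
    simp [martingaleDiff_eq_zero hI h] at h_ne
  exact ⟨n, hn.1, by rw [eLpNorm_martingaleDiff_sq_div_entropyBump α u g hn]⟩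

end AllAtoms

end AtomicFiltration

theorem mainTheorem3 {X : Type*} [MeasurableSpace X] (μ : Measure X) [SigmaFinite μ]
    (D : AtomicFiltration μ)
    (α : ℝ → ℝ≥0) (hα : MonotoneOn α (Ici 1)) (hC : bumpConst α < ∞)
    (u : X → ℝ≥0) (hu : Measurable u)
    (hu_int : ∀ I ∈ D.allAtoms, ∫⁻ x in I, (u x : ℝ≥0∞) ∂μ < ∞)
    {𝕜 : Type*} [RCLike 𝕜] (f : X → 𝕜)
    (hf : MemLp f 2 (μ.withDensity fun x => (u x : ℝ≥0∞))) :
    ∑' I : D.allAtoms,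
        (eLpNorm (D.martingaleDiff (I : Set X) fun x => ((u x : ℝ) : 𝕜) * f x) 1
            (ProbabilityTheory.cond μ (I : Set X))) ^ 2 /
          entropyBump α (ProbabilityTheory.cond μ (I : Set X)) u * μ (I : Set X) ≤
      36 * bumpConst α * (eLpNorm f 2 (μ.withDensity fun x => (u x : ℝ≥0∞))) ^ 2 := by
  have hg : AEStronglyMeasurable (fun x => ((u x : ℝ) : 𝕜) * f x) μ := by
    simpa only [← RCLike.real_smul_eq_coe_mul] using
      (aestronglyMeasurable_withDensity_iff hu).1 hf.aestronglyMeasurable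
  have h_energy : ∫⁻ x, ‖((u x : ℝ) : 𝕜) * f x‖ₑ ^ 2 / (u x : ℝ≥0∞) ∂μ =
      eLpNorm f 2 (μ.withDensity fun x => (u x : ℝ≥0∞)) ^ 2 := by
    simp_rw [eLpNorm_two_withDensity_sq hu, RCLike.real_smul_eq_coe_mul]
  calc _
    _ ≤ ∑' n, ∫⁻ y, D.generationTerm α u (fun x => ((u x : ℝ) : 𝕜) * f x) n (D.cell n y) ∂μ :=
      D.tsum_eLpNorm_martingaleDiff_le α u _
    _ ≤ 34 * bumpConst α * ∫⁻ x, ‖((u x : ℝ) : 𝕜) * f x‖ₑ ^ 2 / (u x : ℝ≥0∞) ∂μ :=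
      D.tsum_lintegral_generationTerm_le hα hC.ne hu (fun I hI => (hu_int I hI).ne) hg
    _ ≤ 36 * bumpConst α * eLpNorm f 2 (μ.withDensity fun x => (u x : ℝ≥0∞)) ^ 2 := by
      rw [h_energy]
      gcongr
      norm_num
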